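/- Let $\mathcal O$ be a compact discrete valuation ring of characteristic $0$ with uniformizer $\pi$ and residue field $\mathbb F_q$ of characteristic $p$. Let $n\ge 2$ and let $A$ be an $n$-dimensional $\mathcal O$-algebra, that is, a free $\mathcal O$-module of rank $n$ with an $\mathcal O$-bilinear multiplication (not necessarily associative, commutative or unital). Suppose that $A$ is graded: there is a decomposition $A=\bigoplus_{j\ge 1}A_j$ into free $\mathcal O$-modules with $A_k\cdot A_l\subseteq A_{k+l}$ for all $k,l\ge 1$. A lattice in $A$ is an $\mathcal O$-submodule $\Lambda\le A$ of finite index. It is called primitive if $\pi^{-1}\Lambda\not\subseteq A$ (equivalently $\Lambda\not\subseteq \pi A$), and its weight is the least $w\in\mathbb N=\{0,1,2,\dots\}$ such that $\pi^w\Lambda$ is closed under the multiplication of $A$. For $i,w\in\mathbb N$ let $\tilde a^w_{q^i}(A)$ be the number of primitive lattices in $A$ of index $q^i$ and weight $w$; this number is finite. Write $v_q(a)=\sup\{m\in\mathbb N : q^m\mid a\}$, so $v_q(0)=\infty$. Then for all $(i,w)\in\mathbb N^2$ $$v_q\bigl(\tilde a^w_{q^i}(A)\bigr)\ \ge\ \left\lfloor\frac{i}{n(n-1)^2}\right\rfloor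 .$$ Consequently the double series $\sum_{(i,w)\in\mathbb N^2}\tilde a^w_{q^i}(A)$ is absolutely $p$-adically convergent, that is, $\sum_{(i,w)\in\mathbb N^2}\bigl|\tilde a^w_{q^i}(A)\bigr|_p<\infty$. -/

import Mathlib

open scoped Pointwise

/-- The `O`-submodule `Λ` of `A` is closed under multiplication, i.e. it is a subalgebra. -/
def IsMulClosed {O A : Type*} [CommRing O] [NonUnitalNonAssocRing A] [Module O A]
    (Λ : Submodule O A) : Prop :=
  ∀ x ∈ Λ, ∀ y ∈ Λ, x * y ∈ Λ

/-- `A` admits a grading `A = ⨁_{j ≥ 1} A_j` into free `O`-modules with `A_k * A_l ⊆ A_{k+l}`. -/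
def IsGradedAlgebra (O A : Type*) [CommRing O] [NonUnitalNonAssocRing A] [Module O A] : Prop :=
  ∃ 𝒜 : ℕ+ → Submodule O A, DirectSum.IsInternal 𝒜 ∧ (∀ j, Module.Free O (𝒜 j)) ∧
    ∀ k l : ℕ+, ∀ x ∈ 𝒜 k, ∀ y ∈ 𝒜 l, x * y ∈ 𝒜 (k + l)

/-- `Λ` is primitive: `π⁻¹ Λ` is not contained in `A`, i.e. `Λ` is not contained in `π A`. -/
def IsPrimitiveLattice {O A : Type*} [CommRing O] [NonUnitalNonAssocRing A] [Module O A]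
    (π : O) (Λ : Submodule O A) : Prop :=
  ¬ Λ ≤ π • (⊤ : Submodule O A)

/-- The weight of `Λ`: the least `w` such that `π ^ w Λ` is a subalgebra. Such a `w` exists
whenever `Λ` has index `q ^ i`, since then `π ^ i Λ` is a subalgebra. -/
noncomputable def latticeWeight {O A : Type*} [CommRing O] [NonUnitalNonAssocRing A] [Module O A]
    (π : O) (Λ : Submodule O A) : ℕ :=
  sInf {w : ℕ | IsMulClosed (π ^ w • Λ)}

/-- The primitive lattices `Λ ≤ A` of index `q ^ i` and weight `w`, where `q` is the
cardinality of the residue field. -/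
def primitiveLattices {O : Type*} (A : Type*) [CommRing O] [IsLocalRing O]
    [NonUnitalNonAssocRing A] [Module O A] (π : O) (i w : ℕ) : Set (Submodule O A) :=
  {Λ | Λ.toAddSubgroup.index = Nat.card (IsLocalRing.ResidueField O) ^ i ∧
    IsPrimitiveLattice π Λ ∧ latticeWeight π Λ = w}

/-- The number of primitive lattices `Λ ≤ A` of index `q ^ i` and weight `w`. -/
noncomputable def numPrimitiveLattices {O : Type*} (A : Type*) [CommRing O] [IsLocalRing O]
    [NonUnitalNonAssocRing A] [Module O A] (π : O) (i w : ℕ) : ℕ :=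
  (primitiveLattices A π i w).ncard

/-!
Let `h = ⌊i / (n (n - 1) ^ 2)⌋ ≥ 1`. The lattices of weight `w` are those for which `π ^ w Λ` is
closed under multiplication, minus those for which this already holds for `w - 1`, so it suffices
to show that `q ^ h` divides the number of primitive `Λ` of index `q ^ i` with `π ^ w Λ Λ ⊆ Λ`
(`pow_dvd_ncard_closedPrimitiveLattices`).

Let `π ^ ν` be the exponent of `A / Λ` and `s = ⌈ν / 2⌉`. These lattices are partitioned by the
orbits of the congruence subgroups `1 + π ^ s End A`. Since `π ^ (2 s) A ⊆ Λ`, all second order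
terms lie in `Λ`, and the condition that `(1 + φ) Λ` is closed becomes linear in `φ`: the part of
the orbit of `Λ` that is counted is in bijection with `M / S`, where `M` consists of the `φ`
divisible by `π ^ s` that induce a derivation `Λ → A / Λ`, and `S` of those with `φ Λ ⊆ Λ`
(`card_closed_congruenceOrbit`). It remains to find a `φ ∈ M` with `π ^ (h - 1) φ ∉ S`, since its
class generates a submodule of `M / S` whose order is a power of `q` divisible by `q ^ h`. The
lemmas below write `h = k + 1`.

This is where the grading enters. Multiplication raises degrees and at most `n` degrees occur, so
the left and right multiplications by elements of `Λ`, scaled by `π ^ w`, lower a flag of length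
`n`, and they preserve `Λ`. By the pigeonhole principle along the flag there is a multiple `y` of
a vector whose annihilator modulo `Λ` is `π ^ h O`, and which is killed by all these operators
modulo `Λ` (`IsNilpotentFlag.exists_isKilledVector`), and dually a functional `f` that maps `Λ`
onto `O` and `π ^ w Λ Λ` into `π ^ h O` (`IsNilpotentFlag.exists_isKillingFunctional`). In these
lemmas `f = π ^ (-τ) F` with `F` integral on `A`, and `y` is written `π ^ a • y`. Then `φ = f ⊗ y`
is the required derivation (`exists_infinitesimalDeformation`).

The remaining point is that `φ` is divisible by `π ^ s`. Each pigeonhole argument costs a power of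
`π` of exponent about `n h`. As a primitive lattice satisfies `i ≤ (n - 1) ν`, the exponent `ν` is
large compared with `h`. If a large gap between the elementary divisors of `Λ` isolates the first
or the last of them, the corresponding vector is an approximate eigenvector of the operators,
whose eigenvalues are highly divisible by nilpotency, and the corresponding loss disappears
(`IsNilpotentFlag.isKillingFunctional_of_gap`, `IsNilpotentFlag.isKilledVector_of_gap`). Comparing
the cases gives the bound for every `n ≥ 2` (`IsNilpotentFlag.exists_functional_and_vector`).

The weight of a lattice of index `q ^ i` is at most `i`, so the double series is dominated by `∑
(i + 1) p ^ (-⌊i / N⌋)` with `N = n (n - 1) ^ 2`.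
-/

/-! ### Cardinalities of quotients of a discrete valuation ring -/

section ResidueCardinality

theorem one_lt_card_residueField {O : Type*} [CommRing O] [IsLocalRing O]
    [Finite (IsLocalRing.ResidueField O)] :
    1 < Nat.card (IsLocalRing.ResidueField O) :=
  Finite.one_lt_card

variable {O : Type*} [CommRing O] [IsDomain O] [IsDiscreteValuationRing O] {π : O}

theorem card_quotient_span_uniformizer_pow (hπ : Irreducible π) (h : ℕ) :
    Nat.card (O ⧸ Ideal.span {π ^ h}) = Nat.card (IsLocalRing.ResidueField O) ^ h := by
  have h1 : Ideal.span {π ^ h} = IsLocalRing.maximalIdeal O ^ h := by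
    rw [hπ.maximalIdeal_eq, Ideal.span_singleton_pow]
  have h2 := cardQuot_pow_of_prime (P := IsLocalRing.maximalIdeal O)
    (IsDiscreteValuationRing.not_a_field O) (i := h)
  rw [Submodule.cardQuot_apply, Submodule.cardQuot_apply] at h2
  rw [h1]
  exact h2

theorem uniformizer_pow_dvd_or (hπ : Irreducible π) (c : O) (h : ℕ) :
    π ^ h ∣ c ∨ ∃ t < h, ∃ u : Oˣ, c = u * π ^ t := by
  by_cases hc : c = 0
  · exact Or.inl (hc ▸ dvd_zero _)
  obtain ⟨t, u, rfl⟩ := IsDiscreteValuationRing.eq_unit_mul_pow_irreducible hc hπ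
  by_cases ht : t < h
  · exact Or.inr ⟨t, ht, u, rfl⟩
  · exact Or.inl (Dvd.dvd.mul_left (pow_dvd_pow _ (by omega)) _)

theorem uniformizer_pow_dvd_of_dvd_pow (hπ : Irreducible π) {c : O} {m n h ν : ℕ}
    (hν : m + n * h ≤ ν) (hn : 0 < n) (hc : π ^ ν ∣ π ^ m * c ^ n) : π ^ h ∣ c := by
  rcases uniformizer_pow_dvd_or hπ c h with hd | ⟨t, ht, u, rfl⟩
  · exact hd
  exfalso
  have h1 : π ^ m * (u * π ^ t) ^ n = π ^ (m + n * t) * (u ^ n : Oˣ) := by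
    push_cast; ring
  rw [h1, Units.dvd_mul_right, pow_dvd_pow_iff hπ.ne_zero hπ.not_isUnit] at hc
  have : n * t < n * h := Nat.mul_lt_mul_of_pos_left ht hn
  omega

/-- An element not killed by `π ^ h` generates a copy of `O / (π ^ k)` with `k > h`, whose
cardinality divides that of the module by Lagrange's theorem. -/
theorem pow_succ_dvd_card_of_smul_ne_zero (hπ : Irreducible π) {M : Type*} [AddCommGroup M]
    [Module O M] (h : ℕ) (m : M) (hm : π ^ h • m ≠ 0) :
    Nat.card (IsLocalRing.ResidueField O) ^ (h + 1) ∣ Nat.card M := by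
  let f : O →ₗ[O] M := LinearMap.toSpanSingleton O M m
  have hle : f.toAddMonoidHom.ker ≤ (Ideal.span {π ^ (h + 1)}).toAddSubgroup := by
    intro c hc
    have hc' : c • m = 0 := hc
    rw [Submodule.mem_toAddSubgroup, Ideal.mem_span_singleton]
    rcases uniformizer_pow_dvd_or hπ c (h + 1) with hd | ⟨t, ht, u, rfl⟩
    · exact hd
    exfalso
    apply hm
    have h1 : π ^ h = (π ^ (h - t) * (u⁻¹ : Oˣ)) * (u * π ^ t) := by
      have : π ^ h = π ^ (h - t) * π ^ t := by rw [← pow_add]; congr 1; omega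
      rw [this]
      linear_combination (-(π ^ (h - t) * π ^ t)) * u.inv_mul
    rw [h1, mul_smul, hc', smul_zero]
  have h1 : (Ideal.span {π ^ (h + 1)}).toAddSubgroup.index
      = Nat.card (IsLocalRing.ResidueField O) ^ (h + 1) :=
    card_quotient_span_uniformizer_pow hπ (h + 1)
  rw [← h1]
  refine (AddSubgroup.index_dvd_of_le hle).trans ?_
  rw [AddSubgroup.index_ker]
  exact AddSubgroup.card_addSubgroup_dvd_card _

end ResidueCardinality

/-! ### Lattices, their index and their exponent -/

section SubmoduleMembership

variable {O A : Type*} [CommRing O] [AddCommGroup A] [Module O A]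

theorem mem_smul_top_iff {a : O} {x : A} :
    x ∈ a • (⊤ : Submodule O A) ↔ ∃ z, a • z = x := by
  simp [Submodule.mem_smul_pointwise_iff_exists]

theorem smul_top_le_iff {a : O} {Λ : Submodule O A} :
    a • (⊤ : Submodule O A) ≤ Λ ↔ ∀ z, a • z ∈ Λ := by
  constructor
  · intro h z
    exact h (mem_smul_top_iff.2 ⟨z, rfl⟩)
  · intro h x hx
    obtain ⟨z, rfl⟩ := mem_smul_top_iff.1 hx
    exact h z

theorem pow_smul_mem_of_le {Λ : Submodule O A} {x : A} {π : O} {a b : ℕ} (hab : a ≤ b)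
    (h : π ^ a • x ∈ Λ) : π ^ b • x ∈ Λ := by
  rw [← Nat.sub_add_cancel hab, pow_add, mul_smul]
  exact Λ.smul_mem _ h

end SubmoduleMembership

section Lattices

variable {O A : Type*} [CommRing O] [IsDomain O] [IsDiscreteValuationRing O] {π : O}
  [AddCommGroup A] [Module O A]

/-- A lattice of index `q ^ i` contains `π ^ i A`. -/
theorem pow_smul_top_le_of_index [Finite (IsLocalRing.ResidueField O)] (hπ : Irreducible π)
    {Λ : Submodule O A} {i : ℕ}
    (hi : Λ.toAddSubgroup.index = Nat.card (IsLocalRing.ResidueField O) ^ i) :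
    π ^ i • (⊤ : Submodule O A) ≤ Λ := by
  rw [smul_top_le_iff]
  intro z
  by_contra hz
  have h1 := pow_succ_dvd_card_of_smul_ne_zero hπ i (Λ.mkQ z) (by
    rwa [← map_smul, Submodule.mkQ_apply, ne_eq, Submodule.Quotient.mk_eq_zero])
  have h2 : Nat.card (A ⧸ Λ) = Nat.card (IsLocalRing.ResidueField O) ^ i := hi
  rw [h2, Nat.pow_dvd_pow_iff_le_right one_lt_card_residueField] at h1
  omega

/-- If `A / Λ` is generated by the images of vectors `b j` killed by `π ^ e j`, then it is a
quotient of the product of the `O / (π ^ e j)`, so the exponent of its cardinality is at most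
the sum of the `e j`. -/
theorem le_sum_of_index_eq [Finite (IsLocalRing.ResidueField O)] (hπ : Irreducible π)
    {Λ : Submodule O A} {i : ℕ}
    (hi : Λ.toAddSubgroup.index = Nat.card (IsLocalRing.ResidueField O) ^ i)
    {ι : Type*} [Fintype ι] (b : ι → A) (e : ι → ℕ) (hb : Λ ⊔ Submodule.span O (Set.range b) = ⊤)
    (he : ∀ j, π ^ e j • b j ∈ Λ) : i ≤ ∑ j, e j := by
  classical
  let g : ∀ j, (O ⧸ Ideal.span {π ^ e j}) →ₗ[O] A ⧸ Λ := fun j =>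
    Submodule.liftQ _ (LinearMap.toSpanSingleton O (A ⧸ Λ) (Λ.mkQ (b j))) (by
      rw [Ideal.span, Submodule.span_singleton_le_iff_mem, LinearMap.mem_ker,
        LinearMap.toSpanSingleton_apply, ← map_smul, Submodule.mkQ_apply,
        Submodule.Quotient.mk_eq_zero]
      exact he j)
  let G : (∀ j, O ⧸ Ideal.span {π ^ e j}) →ₗ[O] A ⧸ Λ := LinearMap.lsum O _ O g
  have hG : Function.Surjective G := by
    rw [← LinearMap.range_eq_top, eq_top_iff]
    have h1 : (⊤ : Submodule O (A ⧸ Λ)) = (Submodule.span O (Set.range b)).map Λ.mkQ := by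
      have := congrArg (Submodule.map Λ.mkQ) hb
      rw [Submodule.map_sup, Submodule.map_top, Submodule.range_mkQ] at this
      rw [← this, sup_eq_right]
      rintro _ ⟨x, hx, rfl⟩
      rw [Submodule.mkQ_apply, (Submodule.Quotient.mk_eq_zero Λ).2 hx]
      exact Submodule.zero_mem _
    rw [h1, Submodule.map_span_le]
    rintro _ ⟨j, rfl⟩
    refine ⟨Pi.single j (Submodule.Quotient.mk 1), ?_⟩
    simp only [G, LinearMap.lsum_piSingle]
    change (1 : O) • (Λ.mkQ (b j)) = _
    rw [one_smul]
  have hfin : ∀ j, Finite (O ⧸ Ideal.span {π ^ e j}) := fun j => by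
    apply Nat.finite_of_card_ne_zero
    rw [card_quotient_span_uniformizer_pow hπ]
    exact pow_ne_zero _ (by have := one_lt_card_residueField (O := O); omega)
  have h2 := Nat.card_le_card_of_surjective G hG
  have h3 : Nat.card (A ⧸ Λ) = Nat.card (IsLocalRing.ResidueField O) ^ i := hi
  rw [h3, Nat.card_pi] at h2
  simp only [card_quotient_span_uniformizer_pow hπ, Finset.prod_pow_eq_pow_sum] at h2
  exact (Nat.pow_le_pow_iff_right one_lt_card_residueField).1 h2

theorem exists_dual_eq_one [Module.Free O A] [Module.Finite O A] (hπ : Irreducible π) {z : A}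
    (hz : z ∉ π • (⊤ : Submodule O A)) : ∃ F : A →ₗ[O] O, F z = 1 := by
  let b := Module.Free.chooseBasis O A
  by_cases hu : ∃ j, IsUnit (b.repr z j)
  · obtain ⟨j, u, hj⟩ := hu
    refine ⟨(u⁻¹ : Oˣ) • b.coord j, ?_⟩
    rw [LinearMap.smul_apply, Module.Basis.coord_apply, ← hj, Units.smul_def, smul_eq_mul,
      Units.inv_mul]
  · exfalso
    push Not at hu
    have h1 : ∀ j, ∃ c, b.repr z j = π * c := fun j => by
      have := (IsLocalRing.mem_maximalIdeal _).2 (hu j)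
      rwa [hπ.maximalIdeal_eq, Ideal.mem_span_singleton] at this
    choose c hc using h1
    apply hz
    rw [mem_smul_top_iff]
    refine ⟨∑ j, c j • b j, ?_⟩
    rw [← b.sum_repr z, Finset.smul_sum]
    simp only [hc, mul_smul]

theorem finite_setOf_pow_smul_top_le [Finite (IsLocalRing.ResidueField O)] [Module.Finite O A]
    (hπ : Irreducible π) (i : ℕ) :
    {Λ : Submodule O A | π ^ i • (⊤ : Submodule O A) ≤ Λ}.Finite := by
  let I := Ideal.span {π ^ i}
  have : Finite (O ⧸ I) := by
    apply Nat.finite_of_card_ne_zero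
    rw [card_quotient_span_uniformizer_pow hπ]
    exact pow_ne_zero _ (by have := one_lt_card_residueField (O := O); omega)
  let N : Submodule O A := I • ⊤
  have hNf : Module.Finite (O ⧸ I) (A ⧸ N) := Module.Finite.of_restrictScalars_finite O _ _
  have : Finite (A ⧸ N) := Module.finite_of_finite (O ⧸ I)
  have : Finite (Submodule O (A ⧸ N)) := Finite.of_injective _ SetLike.coe_injective
  refine (Set.finite_range (Submodule.comap N.mkQ)).subset ?_
  intro Λ hΛ
  refine ⟨Λ.map N.mkQ, ?_⟩
  rw [Submodule.comap_map_mkQ, sup_eq_right]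
  simpa [N, I, Submodule.ideal_span_singleton_smul] using hΛ

end Lattices

/-! ### Operators lowering a flag -/

section NilpotentOperators

variable {O A : Type*} [CommRing O] [AddCommGroup A] [Module O A]

theorem exists_lt_and_not_succ {P : ℕ → Prop} {n : ℕ} (h0 : P 0) (hn : ¬ P n) :
    ∃ j < n, P j ∧ ¬ P (j + 1) := by
  by_contra! hc
  have : ∀ j ≤ n, P j := fun j => by
    induction j with
    | zero => exact fun _ => h0
    | succ j ih => exact fun hj => hc j (by omega) (ih (by omega))
  exact hn (this n le_rfl)

/-- `V` is a decreasing chain from `A` to `0` of length `n` along which every operator in `𝒯`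
moves one step down, so that products of `n` operators in `𝒯` vanish. -/
structure IsNilpotentFlag (𝒯 : Set (Module.End O A)) (n : ℕ) (V : ℕ → Submodule O A) : Prop where
  zero : V 0 = ⊤
  last : V n = ⊥
  step : ∀ T ∈ 𝒯, ∀ j, ∀ x ∈ V j, T x ∈ V (j + 1)

/-- `π ^ a • y` has order exactly `π ^ (k + 1)` modulo `Λ` and is mapped into `Λ` by all
operators in `𝒯`. -/
structure IsKilledVector (π : O) (𝒯 : Set (Module.End O A)) (Λ : Submodule O A) (k a : ℕ) (y : A) :
    Prop where
  mem : π ^ (a + (k + 1)) • y ∈ Λ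
  notMem : π ^ (a + k) • y ∉ Λ
  killed : ∀ T ∈ 𝒯, π ^ a • T y ∈ Λ

/-- `π ^ (-τ) F` maps `Λ` onto `O`, and maps `T Λ` into `π ^ (k + 1) O` for all operators `T`
in `𝒯`. -/
structure IsKillingFunctional (π : O) (𝒯 : Set (Module.End O A)) (Λ : Submodule O A) (k τ : ℕ)
    (F : A →ₗ[O] O) : Prop where
  dvd : ∀ x ∈ Λ, π ^ τ ∣ F x
  not_dvd : ∃ x ∈ Λ, ¬ π ^ (τ + 1) ∣ F x
  kills : ∀ T ∈ 𝒯, ∀ x ∈ Λ, π ^ (τ + (k + 1)) ∣ F (T x)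

/-- The order modulo `Λ` of suitable vectors in the successive steps of the flag drops from
`π ^ ν` to `1`; once it drops by more than `k`, a multiple of the vector before the drop is
as required. -/
theorem IsNilpotentFlag.exists_isKilledVector {π : O} {𝒯 : Set (Module.End O A)} {n : ℕ}
    {V : ℕ → Submodule O A} (hV : IsNilpotentFlag 𝒯 n V) {Λ : Submodule O A} {k ν : ℕ}
    (hν : π ^ ν • (⊤ : Submodule O A) ≤ Λ) {y₀ : A} (hy₀ : π ^ (ν - 1) • y₀ ∉ Λ)
    (hk : n * k + 1 ≤ ν) :
    ∃ a y, ν ≤ a + (n * k + 1) ∧ IsKilledVector π 𝒯 Λ k a y := by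
  classical
  -- Going one step down the flag, the order allowed by the predicate drops by `π ^ k`.
  obtain ⟨j, hj, ⟨y, hyV, hy⟩, hj'⟩ := exists_lt_and_not_succ (n := n)
    (P := fun j => ∃ y ∈ V j, π ^ (ν - 1 - j * k) • y ∉ Λ)
    ⟨y₀, by rw [hV.zero]; trivial, by simpa using hy₀⟩ (by
      rintro ⟨y, hy, h⟩
      rw [hV.last, Submodule.mem_bot] at hy
      rw [hy, smul_zero] at h
      exact h Λ.zero_mem)
  push Not at hj'
  have hex : ∃ o, π ^ o • y ∈ Λ := ⟨ν, smul_top_le_iff.1 hν y⟩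
  have ho := Nat.find_spec hex
  have ho' : ∀ m < Nat.find hex, π ^ m • y ∉ Λ := fun m hm => Nat.find_min hex hm
  generalize Nat.find hex = o at ho ho'
  have hlt : ν - 1 - j * k < o := by
    by_contra hle
    exact hy (pow_smul_mem_of_le (by omega) ho)
  have hjk : (j + 1) * k ≤ n * k := Nat.mul_le_mul_right _ hj
  rw [add_mul, one_mul] at hjk hj'
  refine ⟨o - (k + 1), y, by omega, ⟨?_, ho' _ (by omega), fun T hT => ?_⟩⟩
  · rwa [Nat.sub_add_cancel (by omega)]
  · exact pow_smul_mem_of_le (by omega) (hj' (T y) (hV.step T hT j y hyV))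

/-- The dual of `IsNilpotentFlag.exists_isKilledVector`, for functionals vanishing on the steps
of the flag. -/
theorem IsNilpotentFlag.exists_isKillingFunctional {π : O} {𝒯 : Set (Module.End O A)} {n : ℕ}
    {V : ℕ → Submodule O A} (hV : IsNilpotentFlag 𝒯 n V) {Λ : Submodule O A} (k : ℕ)
    {F₀ : A →ₗ[O] O} {u : A} (hu : u ∈ Λ) (hF₀ : ¬ π ∣ F₀ u) :
    ∃ τ F, τ ≤ (n - 1) * k ∧ IsKillingFunctional π 𝒯 Λ k τ F := by
  classical
  obtain ⟨j, hj, ⟨F, hFV, hF⟩, hj'⟩ := exists_lt_and_not_succ (n := n)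
    (P := fun j => ∃ F : A →ₗ[O] O, (∀ x ∈ V (n - j), F x = 0) ∧ ∃ x ∈ Λ, ¬ π ^ (1 + j * k) ∣ F x)
    ⟨F₀, fun x hx => by
        rw [Nat.sub_zero, hV.last, Submodule.mem_bot] at hx
        rw [hx, map_zero],
      u, hu, by simpa using hF₀⟩ (by
      rintro ⟨F, hF, x, -, h⟩
      rw [Nat.sub_self, hV.zero] at hF
      rw [hF x trivial] at h
      exact h (dvd_zero _))
  push Not at hj'
  have hex : ∃ t, ∃ x ∈ Λ, ¬ π ^ t ∣ F x := ⟨_, hF⟩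
  have ht := Nat.find_spec hex
  have hle : Nat.find hex ≤ 1 + j * k := Nat.find_min' hex hF
  have ht' : ∀ m < Nat.find hex, ∀ x ∈ Λ, π ^ m ∣ F x := fun m hm => by
    simpa using Nat.find_min hex hm
  generalize Nat.find hex = t at ht ht' hle
  obtain ⟨τ, rfl⟩ : ∃ τ, t = τ + 1 := by
    cases t with
    | zero => obtain ⟨x, -, h⟩ := ht; simp at h
    | succ τ => exact ⟨τ, rfl⟩
  have hjk : j * k ≤ (n - 1) * k := Nat.mul_le_mul_right _ (by omega)
  refine ⟨τ, F, by omega, ⟨ht' τ (by omega), ht, fun T hT x hx => ?_⟩⟩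
  refine (pow_dvd_pow π ?_).trans (hj' (F ∘ₗ T) (fun z hz => hFV _ ?_) x hx)
  · rw [add_mul]; omega
  · have := hV.step T hT _ z hz
    rwa [show n - (j + 1) + 1 = n - j by omega] at this

theorem IsNilpotentFlag.iterate_eq_zero {𝒯 : Set (Module.End O A)} {n : ℕ}
    {V : ℕ → Submodule O A} (hV : IsNilpotentFlag 𝒯 n V) {T : Module.End O A} (hT : T ∈ 𝒯) (x : A) :
    (T ^ n) x = 0 := by
  have : ∀ j, (T ^ j) x ∈ V j := fun j => by
    induction j with
    | zero => rw [hV.zero]; trivial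
    | succ j ih =>
      rw [pow_succ', Module.End.mul_apply]
      exact hV.step T hT j _ ih
  simpa [hV.last] using this n

/-- If `v` is an eigenvector of a nilpotent operator `T` modulo an invariant submodule, the
power `c ^ n` of the eigenvalue kills `v` modulo that submodule. -/
theorem pow_smul_mem_of_apply_sub_smul_mem {N : Submodule O A} {T : Module.End O A} {n : ℕ} {v : A}
    {c : O} (hN : ∀ x ∈ N, T x ∈ N) (hv : T v - c • v ∈ N) (hT : (T ^ n) v = 0) :
    c ^ n • v ∈ N := by
  have : ∀ j, (T ^ j) v - c ^ j • v ∈ N := fun j => by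
    induction j with
    | zero => simp
    | succ j ih =>
      have h1 : (T ^ (j + 1)) v - c ^ (j + 1) • v
          = T ((T ^ j) v - c ^ j • v) + c ^ j • (T v - c • v) := by
        rw [pow_succ', Module.End.mul_apply, map_sub, map_smul, smul_sub, smul_smul, ← pow_succ]
        abel
      rw [h1]
      exact N.add_mem (hN _ ih) (N.smul_mem _ hv)
  have h := this n
  rw [hT, zero_sub, N.neg_mem_iff] at h
  exact h

end NilpotentOperators

/-! ### Gaps between elementary divisors -/

section LargeGap

variable {O A : Type*} [CommRing O] [IsDomain O] [IsDiscreteValuationRing O] {π : O}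
  [AddCommGroup A] [Module O A]

/-- If the largest elementary divisor `π ^ ν` of `Λ` is far from the others, which divide `π ^ m`,
then the corresponding vector is an approximate eigenvector of all operators, and nilpotency
forces its eigenvalues to be divisible by `π ^ (k + 1)`. -/
theorem IsNilpotentFlag.isKilledVector_of_gap (hπ : Irreducible π) {𝒯 : Set (Module.End O A)}
    {n : ℕ} (hn : 0 < n) {V : ℕ → Submodule O A} (hV : IsNilpotentFlag 𝒯 n V) {Λ : Submodule O A}
    (hΛ : ∀ T ∈ 𝒯, ∀ x ∈ Λ, T x ∈ Λ) {k ν m : ℕ}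
    (hν : π ^ ν • (⊤ : Submodule O A) ≤ Λ) {y₀ : A} (hy₀ : π ^ (ν - 1) • y₀ ∉ Λ) {v : A}
    (hv : ∀ x : A, ∃ c : O, π ^ m • (x - c • v) ∈ Λ) (hm : m + n * (k + 1) ≤ ν) :
    IsKilledVector π 𝒯 Λ k (ν - (k + 1)) v := by
  have hnk : k + 1 ≤ n * (k + 1) := Nat.le_mul_of_pos_left _ hn
  have hv1 : π ^ (ν - 1) • v ∉ Λ := by
    intro h
    obtain ⟨c, hc⟩ := hv y₀
    apply hy₀
    have h1 := Λ.add_mem (pow_smul_mem_of_le (b := ν - 1) (by omega) hc) (Λ.smul_mem c h)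
    rwa [smul_comm c, ← smul_add, sub_add_cancel] at h1
  refine ⟨?_, ?_, fun T hT => ?_⟩
  · rw [Nat.sub_add_cancel (by omega)]
    exact smul_top_le_iff.1 hν v
  · rwa [show ν - (k + 1) + k = ν - 1 by omega]
  obtain ⟨c, hc⟩ := hv (T v)
  -- Modulo the submodule of all `x` with `π ^ m • x ∈ Λ`, the vector `v` spans `A`.
  let N : Submodule O A := Λ.comap (π ^ m • LinearMap.id)
  have hN : ∀ {x}, x ∈ N ↔ π ^ m • x ∈ Λ := Iff.rfl
  have h2 : π ^ m • c ^ n • v ∈ Λ := by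
    refine hN.1 (pow_smul_mem_of_apply_sub_smul_mem (T := T) (fun x hx => ?_) (hN.2 hc)
      (hV.iterate_eq_zero hT v))
    rw [hN, ← map_smul]
    exact hΛ T hT _ (hN.1 hx)
  have h3 : π ^ ν ∣ π ^ m * c ^ n := by
    rcases uniformizer_pow_dvd_or hπ (π ^ m * c ^ n) ν with hd | ⟨t, ht, w, hw⟩
    · exact hd
    exfalso
    rw [smul_smul, hw, mul_smul] at h2
    apply hv1
    refine pow_smul_mem_of_le (a := t) (by omega) ?_
    have := Λ.smul_mem (w⁻¹ : Oˣ).1 h2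
    rwa [smul_smul, Units.inv_mul, one_smul] at this
  obtain ⟨d, rfl⟩ := uniformizer_pow_dvd_of_dvd_pow hπ hm hn h3
  have h4 := Λ.add_mem (pow_smul_mem_of_le (b := ν - (k + 1)) (by omega) hc)
    (Λ.smul_mem d (smul_top_le_iff.1 hν v))
  have h5 : π ^ (ν - (k + 1)) • T v
      = π ^ (ν - (k + 1)) • (T v - (π ^ (k + 1) * d) • v) + d • π ^ ν • v := by
    have : π ^ ν = π ^ (ν - (k + 1)) * π ^ (k + 1) := by rw [← pow_add]; congr 1; omega
    rw [this, smul_sub, smul_smul, smul_smul, ← mul_assoc, mul_comm d, sub_add_cancel]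
  rw [h5]
  exact h4

/-- If `Λ` agrees with the line spanned by a primitive vector `u` modulo a high power of `π`,
then `u` is an approximate eigenvector of all operators, and nilpotency forces its eigenvalues
to be divisible by `π ^ (k + 1)`. -/
theorem IsNilpotentFlag.isKillingFunctional_of_gap (hπ : Irreducible π)
    {𝒯 : Set (Module.End O A)} {n : ℕ} (hn : 0 < n) {V : ℕ → Submodule O A}
    (hV : IsNilpotentFlag 𝒯 n V) {Λ : Submodule O A}
    (hΛ : ∀ T ∈ 𝒯, ∀ x ∈ Λ, T x ∈ Λ) {k : ℕ} {u : A} (hu : u ∈ Λ) {F : A →ₗ[O] O} (hF : F u = 1)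
    (hgap : ∀ x ∈ Λ, ∃ (c : O) (z : A), x = c • u + π ^ (n * (k + 1)) • z) :
    IsKillingFunctional π 𝒯 Λ k 0 F := by
  have hnk : k + 1 ≤ n * (k + 1) := Nat.le_mul_of_pos_left _ hn
  refine ⟨by simp, ⟨u, hu, ?_⟩, fun T hT x hx => ?_⟩
  · rw [hF, zero_add, pow_one]
    exact fun h => hπ.not_isUnit (isUnit_of_dvd_one h)
  obtain ⟨c, z, hc⟩ := hgap (T u) (hΛ T hT u hu)
  have h1 := pow_smul_mem_of_apply_sub_smul_mem (N := π ^ (n * (k + 1)) • (⊤ : Submodule O A))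
    (T := T) (v := u) (c := c) (fun x hx => by
      obtain ⟨z, rfl⟩ := mem_smul_top_iff.1 hx
      exact mem_smul_top_iff.2 ⟨T z, (map_smul _ _ _).symm⟩)
    (mem_smul_top_iff.2 ⟨z, by rw [hc]; abel⟩) (hV.iterate_eq_zero hT u)
  obtain ⟨z', hz'⟩ := mem_smul_top_iff.1 h1
  have h2 : π ^ (k + 1) ∣ c := by
    refine uniformizer_pow_dvd_of_dvd_pow hπ (m := 0) (n := n) (ν := n * (k + 1)) (by omega) hn ?_
    have := congrArg F hz'
    rw [map_smul, map_smul, hF, smul_eq_mul, smul_eq_mul, mul_one] at this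
    exact ⟨F z', by rw [pow_zero, one_mul, this]⟩
  obtain ⟨a, y, rfl⟩ := hgap x hx
  rw [map_add, map_smul, map_smul, hc, map_add, map_smul, map_add, map_smul, map_smul, map_smul, hF,
    zero_add]
  simp only [smul_eq_mul]
  have h3 : π ^ (k + 1) ∣ π ^ (n * (k + 1)) := pow_dvd_pow π hnk
  exact dvd_add (Dvd.dvd.mul_left (dvd_add (Dvd.dvd.mul_right h2 _) (Dvd.dvd.mul_right h3 _)) _)
    (Dvd.dvd.mul_right h3 _)

end LargeGap

/-! ### Elementary divisors of primitive lattices -/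

section GapAnalysis

theorem sub_smul_mem_ker {O A : Type*} [CommRing O] [AddCommGroup A] [Module O A]
    {F : A →ₗ[O] O} {u : A} (hF : F u = 1) (x : A) :
    x - F x • u ∈ LinearMap.ker F := by
  rw [LinearMap.mem_ker, map_sub, map_smul, hF, smul_eq_mul, mul_one, sub_self]

variable {O A : Type*} [CommRing O] [IsDomain O] [IsDiscreteValuationRing O] {π : O}
  [AddCommGroup A] [Module O A]

theorem exists_complement_of_dual_eq_one [Module.Free O A] [Module.Finite O A] {F : A →ₗ[O] O}
    {u : A} (hF : F u = 1) {r : ℕ} (hr : Module.finrank O A = r + 1) :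
    Module.finrank O (LinearMap.ker F) = r ∧
      ∃ b : Fin r → A, ∀ x ∈ LinearMap.ker F, ∃ c : Fin r → O, x = ∑ j, c j • b j := by
  have hrk : Module.finrank O (LinearMap.ker F) = r := by
    have h1 := Submodule.finrank_quotient_add_finrank (LinearMap.ker F)
    have h2 : Function.Surjective F :=
      fun c => ⟨c • u, by rw [map_smul, hF, smul_eq_mul, mul_one]⟩
    rw [(F.quotKerEquivOfSurjective h2).finrank_eq, Module.finrank_self] at h1
    omega
  let B := Module.finBasisOfFinrankEq O (LinearMap.ker F) hrk
  refine ⟨hrk, fun j => B j, fun x hx => ⟨fun j => B.repr ⟨x, hx⟩ j, ?_⟩⟩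
  have := congrArg (Submodule.subtype _) (B.sum_repr ⟨x, hx⟩)
  rw [map_sum] at this
  simpa using this.symm

theorem index_exponent_le [Finite (IsLocalRing.ResidueField O)] [Module.Free O A]
    [Module.Finite O A] (hπ : Irreducible π) {r : ℕ} (hr : Module.finrank O A = r + 1)
    {Λ : Submodule O A} {i ν : ℕ}
    (hi : Λ.toAddSubgroup.index = Nat.card (IsLocalRing.ResidueField O) ^ i)
    (hν : π ^ ν • (⊤ : Submodule O A) ≤ Λ) {u : A} (hu : u ∈ Λ) {F : A →ₗ[O] O} (hF : F u = 1) :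
    i ≤ r * ν := by
  obtain ⟨-, b, hb⟩ := exists_complement_of_dual_eq_one hF hr
  have := le_sum_of_index_eq hπ hi b (fun _ => ν) (by
    rw [eq_top_iff]
    intro x _
    obtain ⟨c, hc⟩ := hb _ (sub_smul_mem_ker hF x)
    rw [← add_sub_cancel (F x • u) x, hc]
    exact Submodule.add_mem_sup (Λ.smul_mem _ hu) (Submodule.sum_mem _ fun j _ =>
      Submodule.smul_mem _ _ (Submodule.subset_span ⟨j, rfl⟩))) (fun j => smul_top_le_iff.1 hν _)
  simpa using this

/-- If `Λ` is not contained in the line through `u` modulo `π ^ g`, its second elementary divisor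
`π ^ l` satisfies `l < g`. This improves the bound on the index, and in rank three it
makes all of `π ^ l A` lie in `Λ` up to multiples of a single vector. -/
theorem exists_second_elementary_divisor [Finite (IsLocalRing.ResidueField O)] [Module.Free O A]
    [Module.Finite O A] (hπ : Irreducible π) {r : ℕ} (hr : Module.finrank O A = r + 2)
    {Λ : Submodule O A} {i ν : ℕ}
    (hi : Λ.toAddSubgroup.index = Nat.card (IsLocalRing.ResidueField O) ^ i)
    (hν : π ^ ν • (⊤ : Submodule O A) ≤ Λ) {u : A} (hu : u ∈ Λ) {F : A →ₗ[O] O} (hF : F u = 1)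
    {g : ℕ} (hg : ¬ ∀ x ∈ Λ, ∃ (c : O) (z : A), x = c • u + π ^ g • z) :
    ∃ l < g, i ≤ l + r * ν ∧
      (r = 1 → ∃ v : A, ∀ x : A, ∃ c : O, π ^ l • (x - c • v) ∈ Λ) := by
  obtain ⟨l, hl, hP, hP'⟩ := exists_lt_and_not_succ (n := g)
    (P := fun l => ∀ x ∈ Λ, ∃ (c : O) (z : A), x = c • u + π ^ l • z)
    (fun x _ => ⟨0, x, by simp⟩) hg
  push Not at hP'
  obtain ⟨x₀, hx₀, hx₀'⟩ := hP'
  obtain ⟨c₀, z, rfl⟩ := hP x₀ hx₀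
  have hz : π ^ l • z ∈ Λ := by
    have := Λ.sub_mem hx₀ (Λ.smul_mem c₀ hu)
    rwa [add_sub_cancel_left] at this
  let z' : LinearMap.ker F := ⟨z - F z • u, sub_smul_mem_ker hF z⟩
  have hz'Λ : π ^ l • (z' : A) ∈ Λ := by
    change π ^ l • (z - F z • u) ∈ Λ
    rw [smul_sub, smul_comm]
    exact Λ.sub_mem hz (Λ.smul_mem _ (Λ.smul_mem _ hu))
  have hz' : z' ∉ π • (⊤ : Submodule O (LinearMap.ker F)) := by
    intro h
    obtain ⟨t, ht⟩ := mem_smul_top_iff.1 h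
    have ht' : π • (t : A) = z - F z • u := congrArg Subtype.val ht
    apply hx₀' (c₀ + π ^ l * F z) t
    rw [pow_succ, mul_smul, ht', smul_sub, add_smul, mul_smul]
    abel
  obtain ⟨G, hG⟩ := exists_dual_eq_one hπ hz'
  obtain ⟨hrk, -⟩ := exists_complement_of_dual_eq_one hF hr
  obtain ⟨-, b, hb⟩ := exists_complement_of_dual_eq_one hG hrk
  have key : ∀ x : A, ∃ (α β : O) (c : Fin r → O),
      x = α • u + (β • (z' : A) + ∑ j, c j • (b j : A)) := by
    intro x
    let x' : LinearMap.ker F := ⟨x - F x • u, sub_smul_mem_ker hF x⟩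
    obtain ⟨c, hc⟩ := hb _ (sub_smul_mem_ker hG x')
    refine ⟨F x, G x', c, ?_⟩
    have h1 := congrArg (Submodule.subtype _) hc
    rw [map_sum] at h1
    have h2 : x - F x • u - G x' • (z' : A) = ∑ j, c j • (b j : A) := by simpa using h1
    rw [← h2]
    abel
  refine ⟨l, hl, ?_, ?_⟩
  · have := le_sum_of_index_eq hπ hi
      (fun j : Option (Fin r) => j.elim (z' : A) (fun j => (b j : A)))
      (fun j => j.elim l (fun _ => ν)) (by
        rw [eq_top_iff]
        intro x _
        obtain ⟨α, β, c, rfl⟩ := key x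
        exact Submodule.add_mem_sup (Λ.smul_mem _ hu) (Submodule.add_mem _
          (Submodule.smul_mem _ _ (Submodule.subset_span ⟨none, rfl⟩))
          (Submodule.sum_mem _ fun j _ =>
            Submodule.smul_mem _ _ (Submodule.subset_span ⟨some j, rfl⟩)))) (fun j => by
        cases j with
        | none => exact hz'Λ
        | some j => exact smul_top_le_iff.1 hν _)
    rw [Fintype.sum_option] at this
    simpa using this
  · rintro rfl
    refine ⟨b 0, fun x => ?_⟩
    obtain ⟨α, β, c, rfl⟩ := key x
    refine ⟨c 0, ?_⟩
    rw [Fin.sum_univ_one, ← add_assoc, add_sub_cancel_right, smul_add, smul_comm, smul_comm _ β]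
    exact Λ.add_mem (Λ.smul_mem _ (Λ.smul_mem _ hu)) (Λ.smul_mem _ hz'Λ)

/-- The killing functional and the killed vector can be chosen so that the rank one operator
they define is still divisible by `π ^ ((ν + 1) / 2)`. For `n ≥ 4` the losses in both pigeonhole
arguments are affordable; for small `n` a large gap between elementary divisors avoids one or
both of these losses. -/
theorem IsNilpotentFlag.exists_functional_and_vector [Finite (IsLocalRing.ResidueField O)]
    [Module.Free O A] [Module.Finite O A] (hπ : Irreducible π) {n : ℕ} (hn : 2 ≤ n)
    (hr : Module.finrank O A = n) {𝒯 : Set (Module.End O A)} {V : ℕ → Submodule O A}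
    (hV : IsNilpotentFlag 𝒯 n V) {Λ : Submodule O A}
    (hΛ : ∀ T ∈ 𝒯, ∀ x ∈ Λ, T x ∈ Λ) {i ν k : ℕ}
    (hi : Λ.toAddSubgroup.index = Nat.card (IsLocalRing.ResidueField O) ^ i)
    (hprim : ¬ Λ ≤ π • (⊤ : Submodule O A))
    (hν : π ^ ν • (⊤ : Submodule O A) ≤ Λ) {y₀ : A} (hy₀ : π ^ (ν - 1) • y₀ ∉ Λ)
    (hk : n * (n - 1) ^ 2 * (k + 1) ≤ i) :
    ∃ a τ y F, τ + (ν + 1) / 2 ≤ a ∧ IsKilledVector π 𝒯 Λ k a y ∧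
      IsKillingFunctional π 𝒯 Λ k τ F := by
  obtain ⟨u, hu, huπ⟩ := SetLike.not_le_iff_exists.1 hprim
  obtain ⟨F₀, hF₀⟩ := exists_dual_eq_one hπ huπ
  have hF₀' : ¬ π ∣ F₀ u := by
    rw [hF₀]
    exact fun h => hπ.not_isUnit (isUnit_of_dvd_one h)
  obtain ⟨r, rfl⟩ : ∃ r, n = r + 2 := ⟨n - 2, by omega⟩
  rw [show r + 2 - 1 = r + 1 by omega] at hk
  have hi1 := index_exponent_le hπ hr hi hν hu hF₀
  have hν1 : (r + 2) * (r + 1) * (k + 1) ≤ ν := by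
    refine Nat.le_of_mul_le_mul_left (le_trans (le_of_eq ?_) (hk.trans hi1)) (Nat.succ_pos r)
    ring
  -- Whether the second elementary divisor is at least `π ^ (n (k + 1))`.
  by_cases hgap : ∀ x ∈ Λ, ∃ (c : O) (z : A), x = c • u + π ^ ((r + 2) * (k + 1)) • z
  · have hFk := hV.isKillingFunctional_of_gap hπ (by omega) hΛ hu hF₀ hgap
    rcases Nat.eq_zero_or_pos r with rfl | hr0
    · -- In rank two there is only one nontrivial elementary divisor, and it is isolated.
      obtain ⟨-, b, hb⟩ := exists_complement_of_dual_eq_one hF₀ hr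
      have hy := hV.isKilledVector_of_gap hπ (by omega) hΛ (k := k) (m := 0) hν hy₀ (v := b 0)
        (fun x => by
          obtain ⟨c, hc⟩ := hb _ (sub_smul_mem_ker hF₀ x)
          refine ⟨c 0, ?_⟩
          rw [Fin.sum_univ_one] at hc
          rw [← hc, sub_sub_cancel, pow_zero, one_smul]
          exact Λ.smul_mem _ hu) (by omega)
      exact ⟨_, _, _, _, by omega, hy, hFk⟩
    · have h2 : 2 * ((r + 2) * (k + 1)) ≤ ν := by
        refine le_trans ?_ hν1
        calc 2 * ((r + 2) * (k + 1)) ≤ (r + 1) * ((r + 2) * (k + 1)) :=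
              Nat.mul_le_mul_right _ (by omega)
          _ = _ := by ring
      have h3 : (r + 2) * (k + 1) = (r + 2) * k + (r + 2) := by ring
      obtain ⟨a, y, ha, hy⟩ := hV.exists_isKilledVector hν hy₀ (k := k) (by omega)
      exact ⟨_, _, _, _, by omega, hy, hFk⟩
  · obtain ⟨l, hl, hil, hv⟩ := exists_second_elementary_divisor hπ hr hi hν hu hF₀ hgap
    obtain ⟨τ, F, hτ, hF⟩ := hV.exists_isKillingFunctional k hu hF₀'
    rw [show r + 2 - 1 = r + 1 by omega] at hτ
    obtain rfl | rfl | ⟨r, rfl⟩ : r = 0 ∨ r = 1 ∨ ∃ m, r = m + 2 := by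
      rcases r with _ | _ | m
      · exact Or.inl rfl
      · exact Or.inr (Or.inl rfl)
      · exact Or.inr (Or.inr ⟨m, rfl⟩)
    · exfalso; omega
    · -- In rank three the last elementary divisor is isolated, as the second one is small.
      obtain ⟨v, hv⟩ := hv rfl
      have hy := hV.isKilledVector_of_gap hπ (by omega) hΛ (k := k) (m := l) hν hy₀ hv (by omega)
      exact ⟨_, _, _, _, by omega, hy, hF⟩
    · -- The smallness of the second elementary divisor gives `ν ≥ n ^ 2 (k + 1)`, and `n ≥ 4`.
      have h1 : (r + 4) * (r + 4) * (k + 1) ≤ ν := by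
        refine Nat.le_of_mul_le_mul_left (?_ : (r + 2) * _ ≤ (r + 2) * ν) (by omega)
        linarith
      have h2 : 4 * ((r + 4) * (k + 1)) ≤ ν := by
        refine le_trans ?_ h1
        rw [mul_assoc]
        exact Nat.mul_le_mul_right _ (by omega)
      have h3 : (r + 4) * (k + 1) = (r + 2 + 2) * k + (r + 4) := by ring
      have h4 : (r + 2 + 1) * k ≤ (r + 2 + 2) * k := Nat.mul_le_mul_right _ (by omega)
      obtain ⟨a, y, ha, hy⟩ := hV.exists_isKilledVector hν hy₀ (k := k) (by omega)
      exact ⟨_, _, _, _, by omega, hy, hF⟩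

end GapAnalysis

/-! ### The flag of a graded algebra -/

section GradingFlag

variable {O A : Type*} [CommRing O] [IsDomain O] [NonUnitalNonAssocRing A] [Module O A]

/-- Multiplication raises degrees, and at most `n` degrees occur: the `j`-th step of the flag
collects the components whose degree exceeds at least `j` of the occurring degrees. -/
theorem IsGradedAlgebra.exists_flag [Module.IsTorsionFree O A] [Module.Finite O A]
    (hgr : IsGradedAlgebra O A) :
    ∃ V : ℕ → Submodule O A, V 0 = ⊤ ∧ V (Module.finrank O A) = ⊥ ∧
      ∀ a : A, ∀ j, ∀ x ∈ V j, a * x ∈ V (j + 1) ∧ x * a ∈ V (j + 1) := by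
  classical
  obtain ⟨𝒜, hint, -, hmul⟩ := hgr
  have hind := hint.submodule_iSupIndep
  have htop := hint.submodule_iSup_eq_top
  have hfin : Finite {d // 𝒜 d ≠ ⊥} := by
    have h1 := hind.subtype_ne_bot_le_rank
    rw [← Cardinal.mk_lt_aleph0_iff, ← Cardinal.lift_lt_aleph0]
    exact h1.trans_lt (Cardinal.lift_lt_aleph0.2 (Module.rank_lt_aleph0 O A))
  have : Fintype {d // 𝒜 d ≠ ⊥} := Fintype.ofFinite _
  -- `D` is the set of occurring degrees, and `N d` counts those below `d`.
  let D : Finset ℕ+ := Finset.univ.map (Function.Embedding.subtype fun d => 𝒜 d ≠ ⊥)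
  have hD : D.card ≤ Module.finrank O A := by
    rw [Finset.card_map, Finset.card_univ]
    exact hind.subtype_ne_bot_le_finrank
  have hmem : ∀ d, d ∈ D ↔ 𝒜 d ≠ ⊥ := fun d => by simp [D]
  let N : ℕ+ → ℕ := fun d => (D.filter (· < d)).card
  have hN : ∀ d ∈ D, ∀ e, d < e → N d < N e := fun d hd e hde => by
    refine Finset.card_lt_card (Finset.ssubset_iff_of_subset ?_ |>.2 ⟨d, ?_, ?_⟩)
    · intro c hc
      rw [Finset.mem_filter] at hc ⊢
      exact ⟨hc.1, hc.2.trans hde⟩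
    · exact Finset.mem_filter.2 ⟨hd, hde⟩
    · simp
  let V : ℕ → Submodule O A := fun j => ⨆ d, ⨆ _ : j ≤ N d, 𝒜 d
  have hVmem : ∀ {j d x}, j ≤ N d → x ∈ 𝒜 d → x ∈ V j := fun {j d x} hj hx =>
    Submodule.mem_iSup_of_mem d (Submodule.mem_iSup_of_mem hj hx)
  have hprod : ∀ j d e, j ≤ N d → d < e → ∀ x ∈ 𝒜 d, ∀ z ∈ 𝒜 e, (x = 0 → z = 0) →
      z ∈ V (j + 1) := by
    intro j d e hj hde x hx z hz hxz
    by_cases hd : d ∈ D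
    · exact hVmem (hj.trans_lt (hN d hd e hde)) hz
    · rw [hmem, not_not] at hd
      rw [hd, Submodule.mem_bot] at hx
      rw [hxz hx]
      exact Submodule.zero_mem _
  refine ⟨V, ?_, ?_, ?_⟩
  · simpa [V] using htop
  · rw [eq_bot_iff]
    refine iSup_le fun d => iSup_le fun hd => ?_
    by_contra hne
    have hdD : d ∈ D := (hmem d).2 fun h => hne h.le
    have h1 : N d < D.card := by
      refine Finset.card_lt_card (Finset.filter_ssubset.2 ⟨d, hdD, lt_irrefl d⟩)
    omega
  · intro a j x hx
    have ha : a ∈ ⨆ d, 𝒜 d := by rw [htop]; trivial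
    refine Submodule.iSup_induction 𝒜
      (motive := fun a => a * x ∈ V (j + 1) ∧ x * a ∈ V (j + 1)) ha ?_ ?_ ?_
    · intro d a ha
      refine Submodule.iSup_induction _
        (motive := fun x => a * x ∈ V (j + 1) ∧ x * a ∈ V (j + 1)) hx ?_ ?_ ?_
      · intro e x hx
        by_cases hj : j ≤ N e
        · rw [iSup_pos hj] at hx
          exact ⟨hprod j e (d + e) hj (PNat.lt_add_left e d) x hx _ (hmul d e a ha x hx)
              (fun h => by rw [h, mul_zero]),
            hprod j e (e + d) hj (PNat.lt_add_right e d) x hx _ (hmul e d x hx a ha)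
              (fun h => by rw [h, zero_mul])⟩
        · rw [iSup_neg hj, Submodule.mem_bot] at hx
          simp [hx]
      · simp
      · rintro x y ⟨hx1, hx2⟩ ⟨hy1, hy2⟩
        rw [mul_add, add_mul]
        exact ⟨Submodule.add_mem _ hx1 hy1, Submodule.add_mem _ hx2 hy2⟩
    · simp
    · rintro b c ⟨hx1, hx2⟩ ⟨hy1, hy2⟩
      rw [mul_add, add_mul]
      exact ⟨Submodule.add_mem _ hx1 hy1, Submodule.add_mem _ hx2 hy2⟩

end GradingFlag

/-! ### Orbits of congruence subgroups -/

section CongruenceOrbits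

variable {O A : Type*} [CommRing O] [AddCommGroup A] [Module O A]

/-- The orbit of `Λ` under the congruence subgroup of automorphisms of `A` that are the identity
modulo `π ^ s`. -/
def congruenceOrbit (π : O) (s : ℕ) (Λ : Submodule O A) : Set (Submodule O A) :=
  {Λ' | ∃ g : A ≃ₗ[O] A, (∀ x, g x - x ∈ π ^ s • (⊤ : Submodule O A)) ∧
    Λ' = Λ.map (g : A →ₗ[O] A)}

theorem apply_mem_smul_top {a : O} (f : A →ₗ[O] A) {x : A} (hx : x ∈ a • (⊤ : Submodule O A)) :
    f x ∈ a • (⊤ : Submodule O A) := by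
  obtain ⟨z, rfl⟩ := mem_smul_top_iff.1 hx
  exact mem_smul_top_iff.2 ⟨f z, (map_smul _ _ _).symm⟩

theorem self_mem_congruenceOrbit (π : O) (s : ℕ) (Λ : Submodule O A) :
    Λ ∈ congruenceOrbit π s Λ :=
  ⟨LinearEquiv.refl O A, by simp, by simp⟩

theorem congruenceOrbit_subset {π : O} {s : ℕ} {Λ Λ' : Submodule O A}
    (h : Λ' ∈ congruenceOrbit π s Λ) : congruenceOrbit π s Λ' ⊆ congruenceOrbit π s Λ := by
  obtain ⟨g, hg, rfl⟩ := h
  rintro _ ⟨g', hg', rfl⟩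
  refine ⟨g.trans g', fun x => ?_, ?_⟩
  · have := Submodule.add_mem _ (hg' (g x)) (hg x)
    rwa [sub_add_sub_cancel] at this
  · ext; simp

theorem mem_congruenceOrbit_symm {π : O} {s : ℕ} {Λ Λ' : Submodule O A}
    (h : Λ' ∈ congruenceOrbit π s Λ) : Λ ∈ congruenceOrbit π s Λ' := by
  obtain ⟨g, hg, rfl⟩ := h
  refine ⟨g.symm, fun x => ?_, ?_⟩
  · have := hg (g.symm x)
    rw [g.apply_symm_apply] at this
    rw [← neg_sub]
    exact Submodule.neg_mem _ this
  · ext; simp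

theorem congruenceOrbit_eq {π : O} {s : ℕ} {Λ Λ' : Submodule O A}
    (h : Λ' ∈ congruenceOrbit π s Λ) : congruenceOrbit π s Λ' = congruenceOrbit π s Λ :=
  (congruenceOrbit_subset h).antisymm (congruenceOrbit_subset (mem_congruenceOrbit_symm h))

theorem smul_top_le_map_equiv_iff (g : A ≃ₗ[O] A) (a : O) (Λ : Submodule O A) :
    a • (⊤ : Submodule O A) ≤ Λ.map (g : A →ₗ[O] A) ↔ a • (⊤ : Submodule O A) ≤ Λ := by
  rw [smul_top_le_iff, smul_top_le_iff]
  constructor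
  · intro h z
    obtain ⟨x, hx, hxz⟩ := h (g z)
    have : x = a • z := g.injective (by rw [map_smul]; exact hxz)
    rwa [← this]
  · intro h z
    exact ⟨a • g.symm z, h _, by simp⟩

theorem map_equiv_le_smul_top_iff (g : A ≃ₗ[O] A) (a : O) (Λ : Submodule O A) :
    Λ.map (g : A →ₗ[O] A) ≤ a • (⊤ : Submodule O A) ↔ Λ ≤ a • (⊤ : Submodule O A) := by
  constructor
  · intro h x hx
    have := apply_mem_smul_top (g.symm : A →ₗ[O] A) (h ⟨x, hx, rfl⟩)
    simpa using this
  · rintro h _ ⟨x, hx, rfl⟩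
    exact apply_mem_smul_top _ (h hx)

theorem index_map_equiv (g : A ≃ₗ[O] A) (Λ : Submodule O A) :
    (Λ.map (g : A →ₗ[O] A)).toAddSubgroup.index = Λ.toAddSubgroup.index :=
  AddSubgroup.index_map_equiv Λ.toAddSubgroup g.toAddEquiv

theorem exists_linearEquiv_id_add [IsLocalRing O] [Module.Finite O A] {π : O} {s : ℕ}
    (hπ : π ∈ IsLocalRing.maximalIdeal O) (hs : 0 < s) {φ : Module.End O A}
    (hφ : ∀ x, φ x ∈ π ^ s • (⊤ : Submodule O A)) :
    ∃ g : A ≃ₗ[O] A, ∀ x, g x = x + φ x := by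
  have hsurj : Function.Surjective (LinearMap.id + φ : A →ₗ[O] A) := by
    rw [← LinearMap.range_eq_top, eq_top_iff]
    refine Submodule.le_of_le_smul_of_le_jacobson_bot (I := IsLocalRing.maximalIdeal O)
      Module.Finite.fg_top (IsLocalRing.maximalIdeal_le_jacobson _) ?_
    intro x _
    have h1 : φ x ∈ IsLocalRing.maximalIdeal O • (⊤ : Submodule O A) := by
      obtain ⟨z, hz⟩ := mem_smul_top_iff.1 (hφ x)
      rw [← hz]
      exact Submodule.smul_mem_smul (Ideal.pow_mem_of_mem _ hπ s hs) trivial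
    have h2 : x = (LinearMap.id + φ : A →ₗ[O] A) x + -φ x := by simp
    rw [h2]
    exact Submodule.add_mem_sup ⟨x, rfl⟩ (Submodule.neg_mem _ h1)
  exact ⟨LinearEquiv.ofBijective _
    ⟨OrzechProperty.injective_of_surjective_endomorphism _ hsurj, hsurj⟩, fun x => rfl⟩

/-- An automorphism `1 + φ` with `φ` divisible by `π ^ s` moves the elements of `π ^ s A` only
within `π ^ (2 s) A ⊆ Λ`, so `Λ` and its image have the same intersection with `π ^ s A`. -/
theorem mem_map_iff_of_mem_smul_top {π : O} {s : ℕ} {Λ : Submodule O A}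
    (hΛ : π ^ (2 * s) • (⊤ : Submodule O A) ≤ Λ) {φ : Module.End O A}
    (hφ : ∀ x, φ x ∈ π ^ s • (⊤ : Submodule O A)) {g : A ≃ₗ[O] A} (hg : ∀ x, g x = x + φ x) {t : A}
    (ht : t ∈ π ^ s • (⊤ : Submodule O A)) : t ∈ Λ.map (g : A →ₗ[O] A) ↔ t ∈ Λ := by
  obtain ⟨x, rfl⟩ := g.surjective t
  have hx : x ∈ π ^ s • (⊤ : Submodule O A) := by
    have := Submodule.sub_mem _ ht (hφ x)
    rwa [hg, add_sub_cancel_right] at this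
  have hφx : φ x ∈ Λ := by
    obtain ⟨y, rfl⟩ := mem_smul_top_iff.1 hx
    obtain ⟨z, hz⟩ := mem_smul_top_iff.1 (hφ y)
    rw [map_smul, ← hz, smul_smul, ← pow_add, ← two_mul]
    exact smul_top_le_iff.1 hΛ z
  have h1 : g x ∈ Λ.map (g : A →ₗ[O] A) ↔ x ∈ Λ := by
    constructor
    · rintro ⟨y, hy, hyx⟩
      rwa [← g.injective hyx]
    · exact fun h => ⟨x, h, rfl⟩
  rw [h1, hg, Submodule.add_mem_iff_left _ hφx]

end CongruenceOrbits

/-! ### Infinitesimal deformations of a closed lattice -/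

section InfinitesimalDeformations

variable {O A : Type*} [CommRing O] [NonUnitalNonAssocRing A] [Module O A] [IsScalarTower O A A]
  [SMulCommClass O A A]

/-- `Λ` is closed under the multiplication scaled by `π ^ w`. -/
def IsClosedAt (π : O) (w : ℕ) (Λ : Submodule O A) : Prop :=
  ∀ x ∈ Λ, ∀ y ∈ Λ, π ^ w • (x * y) ∈ Λ

/-- The endomorphisms `φ` divisible by `π ^ s` for which `1 + φ` preserves to first order that
`Λ` is closed under the multiplication scaled by `π ^ w`: the induced map from `Λ` to `A / Λ`
is a derivation. -/
def infinitesimalDeformations (π : O) (w s : ℕ) (Λ : Submodule O A) :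
    Submodule O (Module.End O A) where
  carrier := {φ | (∀ x, φ x ∈ π ^ s • (⊤ : Submodule O A)) ∧
    ∀ x ∈ Λ, ∀ y ∈ Λ, π ^ w • (φ x * y + x * φ y - φ (x * y)) ∈ Λ}
  add_mem' := by
    rintro φ ψ ⟨h1, h2⟩ ⟨h3, h4⟩
    refine ⟨fun x => Submodule.add_mem _ (h1 x) (h3 x), fun x hx y hy => ?_⟩
    have := Λ.add_mem (h2 x hx y hy) (h4 x hx y hy)
    rw [← smul_add] at this
    convert this using 2
    simp only [LinearMap.add_apply, add_mul, mul_add]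
    abel
  zero_mem' := by simp
  smul_mem' := by
    rintro c φ ⟨h1, h2⟩
    refine ⟨fun x => Submodule.smul_mem _ _ (h1 x), fun x hx y hy => ?_⟩
    have := Λ.smul_mem c (h2 x hx y hy)
    rw [smul_comm] at this
    convert this using 2
    simp only [LinearMap.smul_apply, smul_mul_assoc, mul_smul_comm, smul_add, smul_sub]

/-- The endomorphisms `φ` divisible by `π ^ s` that preserve `Λ`. -/
def trivialDeformations {A : Type*} [AddCommGroup A] [Module O A] (π : O) (s : ℕ)
    (Λ : Submodule O A) : Submodule O (Module.End O A) where
  carrier := {φ | (∀ x, φ x ∈ π ^ s • (⊤ : Submodule O A)) ∧ ∀ x ∈ Λ, φ x ∈ Λ}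
  add_mem' := by
    rintro φ ψ ⟨h1, h2⟩ ⟨h3, h4⟩
    exact ⟨fun x => Submodule.add_mem _ (h1 x) (h3 x), fun x hx => Λ.add_mem (h2 x hx) (h4 x hx)⟩
  zero_mem' := by simp
  smul_mem' := by
    rintro c φ ⟨h1, h2⟩
    exact ⟨fun x => Submodule.smul_mem _ _ (h1 x), fun x hx => Λ.smul_mem _ (h2 x hx)⟩

theorem isClosedAt_map_iff {π : O} {w s : ℕ} {Λ : Submodule O A} (hcl : IsClosedAt π w Λ)
    (hΛ : π ^ (2 * s) • (⊤ : Submodule O A) ≤ Λ) {φ : Module.End O A}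
    (hφ : ∀ x, φ x ∈ π ^ s • (⊤ : Submodule O A)) {g : A ≃ₗ[O] A} (hg : ∀ x, g x = x + φ x) :
    IsClosedAt π w (Λ.map (g : A →ₗ[O] A)) ↔ φ ∈ infinitesimalDeformations π w s Λ := by
  have key : ∀ x ∈ Λ, ∀ y ∈ Λ, (π ^ w • (g x * g y) ∈ Λ.map (g : A →ₗ[O] A) ↔
      π ^ w • (φ x * y + x * φ y - φ (x * y)) ∈ Λ) := by
    intro x hx y hy
    obtain ⟨x', hx'⟩ := mem_smul_top_iff.1 (hφ x)
    obtain ⟨y', hy'⟩ := mem_smul_top_iff.1 (hφ y)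
    have h1 : π ^ w • (φ x * φ y) ∈ Λ := by
      rw [← hx', ← hy', smul_mul_smul_comm, ← pow_add, ← two_mul]
      exact Λ.smul_mem _ (smul_top_le_iff.1 hΛ _)
    have h2 : π ^ w • (g x * g y) = g (π ^ w • (x * y)) +
        π ^ w • (φ x * y + x * φ y - φ (x * y) + φ x * φ y) := by
      rw [map_smul, ← smul_add, hg x, hg y, hg (x * y), add_mul, mul_add, mul_add]
      congr 1
      abel
    have h3 : π ^ w • (φ x * y + x * φ y - φ (x * y) + φ x * φ y) ∈
        π ^ s • (⊤ : Submodule O A) := by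
      refine Submodule.smul_mem _ _ (Submodule.add_mem _ (Submodule.sub_mem _
        (Submodule.add_mem _ ?_ ?_) (hφ _)) ?_)
      · rw [← hx', smul_mul_assoc]; exact mem_smul_top_iff.2 ⟨_, rfl⟩
      · rw [← hy', mul_smul_comm]; exact mem_smul_top_iff.2 ⟨_, rfl⟩
      · rw [← hx', smul_mul_assoc]; exact mem_smul_top_iff.2 ⟨_, rfl⟩
    have h4 : g (π ^ w • (x * y)) ∈ Λ.map (g : A →ₗ[O] A) := ⟨_, hcl x hx y hy, rfl⟩
    rw [h2, Submodule.add_mem_iff_right _ h4,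
      mem_map_iff_of_mem_smul_top hΛ hφ hg h3, smul_add, Submodule.add_mem_iff_left _ h1]
  constructor
  · intro h
    exact ⟨hφ, fun x hx y hy => (key x hx y hy).1 (h _ ⟨x, hx, rfl⟩ _ ⟨y, hy, rfl⟩)⟩
  · rintro h _ ⟨x, hx, rfl⟩ _ ⟨y, hy, rfl⟩
    exact (key x hx y hy).2 (h.2 x hx y hy)

theorem map_eq_map_iff {A : Type*} [AddCommGroup A] [Module O A] {π : O} {s : ℕ}
    {Λ : Submodule O A} (hΛ : π ^ (2 * s) • (⊤ : Submodule O A) ≤ Λ) {φ φ' : Module.End O A}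
    (hφ : ∀ x, φ x ∈ π ^ s • (⊤ : Submodule O A)) (hφ' : ∀ x, φ' x ∈ π ^ s • (⊤ : Submodule O A))
    {g g' : A ≃ₗ[O] A} (hg : ∀ x, g x = x + φ x) (hg' : ∀ x, g' x = x + φ' x) :
    Λ.map (g : A →ₗ[O] A) = Λ.map (g' : A →ₗ[O] A) ↔ φ - φ' ∈ trivialDeformations π s Λ := by
  have hle : ∀ {φ φ' : Module.End O A} {g g' : A ≃ₗ[O] A},
      (∀ x, φ' x ∈ π ^ s • (⊤ : Submodule O A)) → (∀ x, g x = x + φ x) →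
      (∀ x, g' x = x + φ' x) → φ - φ' ∈ trivialDeformations π s Λ →
      Λ.map (g : A →ₗ[O] A) ≤ Λ.map (g' : A →ₗ[O] A) := by
    rintro φ φ' g g' hφ' hg hg' h _ ⟨x, hx, rfl⟩
    have h1 : g x = g' x + (φ - φ') x := by
      rw [hg, hg', LinearMap.sub_apply]; abel
    change g x ∈ _
    rw [h1]
    exact Submodule.add_mem _ ⟨x, hx, rfl⟩
      ((mem_map_iff_of_mem_smul_top hΛ hφ' hg' (h.1 x)).2 (h.2 x hx))
  constructor
  · intro h
    have h0 : ∀ x, (φ - φ') x ∈ π ^ s • (⊤ : Submodule O A) := fun x =>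
      Submodule.sub_mem _ (hφ x) (hφ' x)
    refine ⟨h0, fun x hx => ?_⟩
    rw [← mem_map_iff_of_mem_smul_top hΛ hφ' hg' (h0 x)]
    have h1 : (φ - φ') x = g x - g' x := by
      rw [hg, hg', LinearMap.sub_apply]; abel
    rw [h1]
    exact Submodule.sub_mem _ (h ▸ ⟨x, hx, rfl⟩) ⟨x, hx, rfl⟩
  · intro h
    refine (hle hφ' hg hg' h).antisymm (hle hφ hg' hg ?_)
    rw [← neg_sub]
    exact Submodule.neg_mem _ h

theorem card_eq_card_quotient {G : Type*} [AddCommGroup G] [Module O G] (N : Submodule O G)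
    {X : Type*} (f : G → X) (hf : Function.Surjective f) (hN : ∀ a b, f a = f b ↔ a - b ∈ N) :
    Nat.card X = Nat.card (G ⧸ N) := by
  refine (Nat.card_congr (Equiv.ofBijective
    (fun q : G ⧸ N => Quotient.liftOn' q f fun a b h => ?_) ⟨?_, ?_⟩)).symm
  · exact (hN a b).2 ((Submodule.quotientRel_def N).1 h)
  · rintro ⟨a⟩ ⟨b⟩ h
    exact (Submodule.Quotient.eq N).2 ((hN a b).1 h)
  · intro x
    obtain ⟨a, rfl⟩ := hf x
    exact ⟨Submodule.Quotient.mk a, rfl⟩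

/-- The lattices in the congruence orbit of `Λ` that are closed at weight `w` correspond to the
infinitesimal deformations modulo the trivial ones: because `π ^ (2 s) A ⊆ Λ`, being closed is
a linear condition on `φ`. -/
theorem card_closed_congruenceOrbit [IsLocalRing O] [Module.Finite O A] {π : O} {w s : ℕ}
    (hπ : π ∈ IsLocalRing.maximalIdeal O) (hs : 0 < s) {Λ : Submodule O A}
    (hcl : IsClosedAt π w Λ) (hΛ : π ^ (2 * s) • (⊤ : Submodule O A) ≤ Λ) :
    Nat.card {Λ' // Λ' ∈ congruenceOrbit π s Λ ∧ IsClosedAt π w Λ'} =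
      Nat.card (infinitesimalDeformations π w s Λ ⧸
        (trivialDeformations π s Λ).submoduleOf (infinitesimalDeformations π w s Λ)) := by
  choose G hG using fun φ : infinitesimalDeformations π w s Λ =>
    exists_linearEquiv_id_add hπ hs φ.2.1
  refine card_eq_card_quotient _ (fun φ => ⟨Λ.map (G φ : A →ₗ[O] A), ⟨G φ, fun x => ?_, rfl⟩,
    (isClosedAt_map_iff hcl hΛ φ.2.1 (hG φ)).2 φ.2⟩) ?_ ?_
  · rw [hG, add_sub_cancel_left]
    exact φ.2.1 x
  · rintro ⟨_, ⟨g, hg, rfl⟩, hgcl⟩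
    have hgφ : ∀ x, g x = x + ((g : A →ₗ[O] A) - LinearMap.id : Module.End O A) x := by simp
    have hφ := (isClosedAt_map_iff hcl hΛ (φ := (g : A →ₗ[O] A) - LinearMap.id)
      (by simpa using hg) hgφ).1 hgcl
    refine ⟨⟨_, hφ⟩, Subtype.ext ?_⟩
    have : G ⟨_, hφ⟩ = g := LinearEquiv.ext fun x => by rw [hG, hgφ x]
    simp only [this]
  · intro φ ψ
    rw [Subtype.mk.injEq, map_eq_map_iff hΛ φ.2.1 ψ.2.1 (hG φ) (hG ψ)]
    rfl

end InfinitesimalDeformations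

/-! ### Counting closed lattices -/

section OrbitCount

variable {O A : Type*} [CommRing O] [IsDomain O] [IsDiscreteValuationRing O]
  [NonUnitalNonAssocRing A] [Module O A] [IsScalarTower O A A] [SMulCommClass O A A]

/-- The left and right multiplications by elements of `Λ`, scaled by `π ^ w`. -/
def scaledMultiplications (π : O) (w : ℕ) (Λ : Submodule O A) : Set (Module.End O A) :=
  {T | ∃ a ∈ Λ, T = π ^ w • LinearMap.mulLeft O a ∨ T = π ^ w • LinearMap.mulRight O a}

/-- The rank one operator `π ^ (a - τ) F ⊗ y` is an infinitesimal deformation, because its values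
on `Λ` are killed by multiplication with `Λ`, and it vanishes on products modulo `Λ`. -/
theorem exists_infinitesimalDeformation {π : O} {w s k a τ : ℕ} {Λ : Submodule O A} {y : A}
    {F : A →ₗ[O] O} (hπ : Irreducible π) (ha : τ + s ≤ a)
    (hy : IsKilledVector π (scaledMultiplications π w Λ) Λ k a y)
    (hF : IsKillingFunctional π (scaledMultiplications π w Λ) Λ k τ F) :
    ∃ φ ∈ infinitesimalDeformations π w s Λ, π ^ k • φ ∉ trivialDeformations π s Λ := by
  have hval : ∀ x c, F x = π ^ τ * c → π ^ (a - τ) • F x • y = c • π ^ a • y := by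
    intro x c hc
    have : π ^ a = π ^ (a - τ) * π ^ τ := by rw [← pow_add]; congr 1; omega
    rw [hc, this, smul_smul, smul_smul]
    congr 1
    ring
  refine ⟨π ^ (a - τ) • F.smulRight y, ⟨fun x => ?_, fun x hx x' hx' => ?_⟩, fun h => ?_⟩
  · rw [LinearMap.smul_apply, mem_smul_top_iff]
    refine ⟨π ^ (a - τ - s) • F x • y, ?_⟩
    rw [smul_smul, ← pow_add, LinearMap.smulRight_apply]
    congr 2; omega
  · simp only [LinearMap.smul_apply, LinearMap.smulRight_apply]
    obtain ⟨c, hc⟩ := hF.dvd x hx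
    obtain ⟨c', hc'⟩ := hF.dvd x' hx'
    obtain ⟨d, hd⟩ := hF.kills _ ⟨x, hx, Or.inl rfl⟩ x' hx'
    have h1 := hy.killed _ ⟨x', hx', Or.inr rfl⟩
    have h2 := hy.killed _ ⟨x, hx, Or.inl rfl⟩
    rw [LinearMap.smul_apply, LinearMap.mulRight_apply] at h1
    rw [LinearMap.smul_apply, LinearMap.mulLeft_apply] at h2
    rw [LinearMap.smul_apply, LinearMap.mulLeft_apply, map_smul] at hd
    rw [hval x c hc, hval x' c' hc', smul_sub, smul_add]
    refine Λ.sub_mem (Λ.add_mem ?_ ?_) ?_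
    · rw [smul_mul_assoc, smul_mul_assoc, smul_comm, smul_comm (π ^ w)]
      exact Λ.smul_mem c h1
    · rw [mul_smul_comm, mul_smul_comm, smul_comm, smul_comm (π ^ w)]
      exact Λ.smul_mem c' h2
    · have h3 := hval (π ^ w • (x * x')) (π ^ (k + 1) * d) (by
        rw [map_smul, hd, pow_add, mul_assoc])
      rw [map_smul, smul_eq_mul, mul_smul, smul_comm _ (π ^ w)] at h3
      rw [h3, mul_comm, mul_smul, smul_smul (π ^ (k + 1)), ← pow_add, add_comm (k + 1)]
      exact Λ.smul_mem d hy.mem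
  · obtain ⟨x, hx, hxF⟩ := hF.not_dvd
    have h1 := h.2 x hx
    obtain ⟨c, hc⟩ := hF.dvd x hx
    rw [LinearMap.smul_apply, LinearMap.smul_apply, LinearMap.smulRight_apply, hval x c hc] at h1
    have hu : IsUnit c := by
      by_contra hu
      have := (IsLocalRing.mem_maximalIdeal _).2 hu
      rw [hπ.maximalIdeal_eq, Ideal.mem_span_singleton] at this
      apply hxF
      rw [hc, pow_succ]
      exact mul_dvd_mul_left _ this
    obtain ⟨u, rfl⟩ := hu
    apply hy.notMem
    have h2 := Λ.smul_mem (u⁻¹ : Oˣ).1 h1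
    rwa [smul_comm (π ^ k), smul_smul _ u.1, Units.inv_mul, one_smul, smul_smul, ← pow_add,
      add_comm k] at h2

theorem dvd_ncard_of_dvd_classes {α β : Type*} {X : Set α} (hX : X.Finite) (c : α → β) {d : ℕ}
    (hd : ∀ x ∈ X, d ∣ {y | y ∈ X ∧ c y = c x}.ncard) : d ∣ X.ncard := by
  classical
  rw [Set.ncard_eq_toFinset_card X hX, Finset.card_eq_sum_card_image c]
  refine Finset.dvd_sum fun b hb => ?_
  obtain ⟨x, hx, rfl⟩ := Finset.mem_image.1 hb
  have h1 := hd x (hX.mem_toFinset.1 hx)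
  rwa [show {y | y ∈ X ∧ c y = c x} = ↑({a ∈ hX.toFinset | c a = c x} : Finset α) by
    ext; simp, Set.ncard_coe_finset] at h1

/-- The primitive lattices of index `q ^ i` that are closed under the multiplication scaled by
`π ^ w`. -/
def closedPrimitiveLattices (A : Type*) [NonUnitalNonAssocRing A] [Module O A] (π : O) (i w : ℕ) :
    Set (Submodule O A) :=
  {Λ | Λ.toAddSubgroup.index = Nat.card (IsLocalRing.ResidueField O) ^ i ∧
    IsPrimitiveLattice π Λ ∧ IsClosedAt π w Λ}

/-- The least `m` such that `π ^ m A ⊆ Λ`, or `0` if there is none. -/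
noncomputable def latticeExponent {O A : Type*} [CommRing O] [AddCommGroup A] [Module O A] (π : O)
    (Λ : Submodule O A) : ℕ :=
  sInf {m | π ^ m • (⊤ : Submodule O A) ≤ Λ}

theorem latticeExponent_map_equiv {O A : Type*} [CommRing O] [AddCommGroup A] [Module O A] (π : O)
    (Λ : Submodule O A) (g : A ≃ₗ[O] A) :
    latticeExponent π (Λ.map (g : A →ₗ[O] A)) = latticeExponent π Λ := by
  simp only [latticeExponent, smul_top_le_map_equiv_iff]

theorem finite_closedPrimitiveLattices {A : Type*} [NonUnitalNonAssocRing A] [Module O A]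
    [Module.Finite O A] [Finite (IsLocalRing.ResidueField O)]
    {π : O} (hπ : Irreducible π) (i w : ℕ) : (closedPrimitiveLattices A π i w).Finite :=
  (finite_setOf_pow_smul_top_le hπ i).subset fun _ hΛ => pow_smul_top_le_of_index hπ hΛ.1

/-- The congruence orbits of level `⌈ν / 2⌉`, for `ν` the exponent of the lattice, partition the
closed lattices into classes whose sizes are divisible by `q ^ (k + 1)`. -/
theorem pow_dvd_ncard_closedPrimitiveLattices [Module.Free O A] [Module.Finite O A]
    [Finite (IsLocalRing.ResidueField O)] {π : O} (hπ : Irreducible π) {n : ℕ} (hn : 2 ≤ n)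
    (hdim : Module.finrank O A = n) (hgr : IsGradedAlgebra O A) {i k : ℕ} (w : ℕ)
    (hk : n * (n - 1) ^ 2 * (k + 1) ≤ i) :
    Nat.card (IsLocalRing.ResidueField O) ^ (k + 1) ∣ (closedPrimitiveLattices A π i w).ncard := by
  obtain ⟨V, hV0, hVn, hVmul⟩ := hgr.exists_flag
  rw [hdim] at hVn
  have hπm : π ∈ IsLocalRing.maximalIdeal O := (IsLocalRing.mem_maximalIdeal _).2 hπ.not_isUnit
  let s : Submodule O A → ℕ := fun Λ => (latticeExponent π Λ + 1) / 2
  refine dvd_ncard_of_dvd_classes (finite_closedPrimitiveLattices hπ i w)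
    (fun Λ => (s Λ, congruenceOrbit π (s Λ) Λ)) fun Λ hΛ => ?_
  obtain ⟨hi, hprim, hcl⟩ := hΛ
  have hflag : IsNilpotentFlag (scaledMultiplications π w Λ) n V := by
    refine ⟨hV0, hVn, ?_⟩
    rintro T ⟨a, -, rfl | rfl⟩ j x hx
    · exact Submodule.smul_mem _ _ (hVmul a j x hx).1
    · exact Submodule.smul_mem _ _ (hVmul a j x hx).2
  have hpres : ∀ T ∈ scaledMultiplications π w Λ, ∀ x ∈ Λ, T x ∈ Λ := by
    rintro T ⟨a, ha, rfl | rfl⟩ x hx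
    · exact hcl a ha x hx
    · exact hcl x hx a ha
  have hνle : π ^ latticeExponent π Λ • (⊤ : Submodule O A) ≤ Λ :=
    Nat.sInf_mem (s := {m | π ^ m • (⊤ : Submodule O A) ≤ Λ})
      ⟨i, pow_smul_top_le_of_index hπ hi⟩
  have hν0 : 0 < latticeExponent π Λ := by
    rw [Nat.pos_iff_ne_zero]
    intro h0
    rw [h0, pow_zero, one_smul, top_le_iff] at hνle
    rw [hνle, Submodule.top_toAddSubgroup, AddSubgroup.index_top] at hi
    have h1 : 0 < n * (n - 1) ^ 2 * (k + 1) := by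
      have : 0 < n - 1 := by omega
      positivity
    exact absurd hi.symm (Nat.one_lt_pow (by omega) one_lt_card_residueField).ne'
  obtain ⟨y₀, hy₀⟩ : ∃ y₀, π ^ (latticeExponent π Λ - 1) • y₀ ∉ Λ := by
    by_contra! h
    have : latticeExponent π Λ ≤ latticeExponent π Λ - 1 := Nat.sInf_le (smul_top_le_iff.2 h)
    omega
  obtain ⟨a, τ, y, F, ha, hy, hF⟩ :=
    hflag.exists_functional_and_vector hπ hn hdim hpres hi hprim hνle hy₀ hk
  obtain ⟨φ, hφ, hφk⟩ := exists_infinitesimalDeformation hπ ha hy hF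
  have hΛs : π ^ (2 * s Λ) • (⊤ : Submodule O A) ≤ Λ :=
    smul_top_le_iff.2 fun z => pow_smul_mem_of_le (by simp only [s]; omega)
      (smul_top_le_iff.1 hνle z)
  have hclass : {Λ' | Λ' ∈ closedPrimitiveLattices A π i w ∧
      (s Λ', congruenceOrbit π (s Λ') Λ') = (s Λ, congruenceOrbit π (s Λ) Λ)} =
      {Λ' | Λ' ∈ congruenceOrbit π (s Λ) Λ ∧ IsClosedAt π w Λ'} := by
    ext Λ'
    constructor
    · rintro ⟨⟨-, -, hcl'⟩, h⟩
      obtain ⟨-, h2⟩ := Prod.mk.inj h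
      exact ⟨h2 ▸ self_mem_congruenceOrbit π _ Λ', hcl'⟩
    · rintro ⟨hmem, hcl'⟩
      obtain ⟨g, -, hg⟩ := id hmem
      have hs : s Λ' = s Λ := by simp only [s, hg, latticeExponent_map_equiv]
      refine ⟨⟨?_, ?_, hcl'⟩, ?_⟩
      · rw [hg, index_map_equiv, hi]
      · rw [IsPrimitiveLattice, hg, map_equiv_le_smul_top_iff]
        exact hprim
      · rw [hs, congruenceOrbit_eq hmem]
  rw [hclass, ← Nat.card_coe_set_eq]
  refine (?_ : _ ∣ Nat.card {Λ' // Λ' ∈ congruenceOrbit π (s Λ) Λ ∧ IsClosedAt π w Λ'})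
  rw [card_closed_congruenceOrbit hπm (by simp only [s]; omega) hcl hΛs]
  refine pow_succ_dvd_card_of_smul_ne_zero hπ k (Submodule.Quotient.mk ⟨φ, hφ⟩) ?_
  rw [← Submodule.Quotient.mk_smul, ne_eq, Submodule.Quotient.mk_eq_zero]
  exact hφk

end OrbitCount

/-! ### Counting lattices of given weight -/

section Weight

variable {O A : Type*} [CommRing O] [IsDomain O] [IsDiscreteValuationRing O]
  [NonUnitalNonAssocRing A] [Module O A] [IsScalarTower O A A] [SMulCommClass O A A]

theorem isMulClosed_smul_iff {O A : Type*} [CommRing O] [IsDomain O] [NonUnitalNonAssocRing A]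
    [Module O A] [IsScalarTower O A A] [SMulCommClass O A A] [Module.IsTorsionFree O A]
    {π : O} (hπ : π ≠ 0) (w : ℕ) (Λ : Submodule O A) :
    IsMulClosed (π ^ w • Λ) ↔ IsClosedAt π w Λ := by
  have key : ∀ x y : A, (π ^ w • x) * (π ^ w • y) = π ^ w • π ^ w • (x * y) := fun x y => by
    rw [smul_mul_smul_comm, mul_smul]
  constructor
  · intro h x hx y hy
    have := h _ (Submodule.smul_mem_pointwise_smul x _ _ hx) _
      (Submodule.smul_mem_pointwise_smul y _ _ hy)
    rw [key, Submodule.mem_smul_pointwise_iff_exists] at this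
    obtain ⟨z, hz, h⟩ := this
    rwa [← smul_right_injective A (pow_ne_zero w hπ) h]
  · intro h x hx y hy
    obtain ⟨x, hx', rfl⟩ := (Submodule.mem_smul_pointwise_iff_exists _ _ _).1 hx
    obtain ⟨y, hy', rfl⟩ := (Submodule.mem_smul_pointwise_iff_exists _ _ _).1 hy
    rw [key]
    exact Submodule.smul_mem_pointwise_smul _ _ _ (h x hx' y hy')

theorem IsClosedAt.mono {O A : Type*} [CommRing O] [NonUnitalNonAssocRing A] [Module O A] {π : O}
    {w w' : ℕ} {Λ : Submodule O A} (hw : w ≤ w') (h : IsClosedAt π w Λ) : IsClosedAt π w' Λ :=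
  fun x hx y hy => pow_smul_mem_of_le hw (h x hx y hy)

theorem isClosedAt_of_smul_top_le {O A : Type*} [CommRing O] [NonUnitalNonAssocRing A]
    [Module O A] {π : O} {i : ℕ}
    {Λ : Submodule O A} (h : π ^ i • (⊤ : Submodule O A) ≤ Λ) : IsClosedAt π i Λ :=
  fun _ _ _ _ => smul_top_le_iff.1 h _

theorem latticeWeight_le_iff {O A : Type*} [CommRing O] [IsDomain O] [NonUnitalNonAssocRing A]
    [Module O A] [IsScalarTower O A A] [SMulCommClass O A A] [Module.IsTorsionFree O A]
    {π : O} (hπ : π ≠ 0) {i w : ℕ}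
    {Λ : Submodule O A} (h : π ^ i • (⊤ : Submodule O A) ≤ Λ) :
    latticeWeight π Λ ≤ w ↔ IsClosedAt π w Λ := by
  simp only [latticeWeight, isMulClosed_smul_iff hπ]
  constructor
  · intro hw
    exact IsClosedAt.mono hw (Nat.sInf_mem (s := {w | IsClosedAt π w Λ})
      ⟨i, isClosedAt_of_smul_top_le h⟩)
  · exact fun hw => Nat.sInf_le hw

theorem primitiveLattices_succ [Module.IsTorsionFree O A] [Finite (IsLocalRing.ResidueField O)]
    {π : O} (hπ : Irreducible π) (i w : ℕ) :
    primitiveLattices A π i (w + 1) =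
      closedPrimitiveLattices A π i (w + 1) \ closedPrimitiveLattices A π i w := by
  ext Λ
  simp only [primitiveLattices, closedPrimitiveLattices, Set.mem_sdiff, Set.mem_ofPred_eq]
  constructor
  · rintro ⟨h1, h2, h3⟩
    have h4 := latticeWeight_le_iff (w := w) hπ.ne_zero (pow_smul_top_le_of_index hπ h1)
    have h5 := latticeWeight_le_iff (w := w + 1) hπ.ne_zero (pow_smul_top_le_of_index hπ h1)
    exact ⟨⟨h1, h2, h5.1 h3.le⟩, fun h => by have := h4.2 h.2.2; omega⟩
  · rintro ⟨⟨h1, h2, h3⟩, h6⟩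
    have h4 := latticeWeight_le_iff (w := w) hπ.ne_zero (pow_smul_top_le_of_index hπ h1)
    have h5 := latticeWeight_le_iff (w := w + 1) hπ.ne_zero (pow_smul_top_le_of_index hπ h1)
    have h7 : ¬ latticeWeight π Λ ≤ w := fun h => h6 ⟨h1, h2, h4.1 h⟩
    exact ⟨h1, h2, by have := h5.2 h3; omega⟩

theorem primitiveLattices_zero [Module.IsTorsionFree O A] [Finite (IsLocalRing.ResidueField O)]
    {π : O} (hπ : Irreducible π) (i : ℕ) :
    primitiveLattices A π i 0 = closedPrimitiveLattices A π i 0 := by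
  ext Λ
  simp only [primitiveLattices, closedPrimitiveLattices, Set.mem_ofPred_eq]
  refine and_congr_right fun h1 => and_congr_right fun _ => ?_
  rw [← latticeWeight_le_iff hπ.ne_zero (pow_smul_top_le_of_index hπ h1), Nat.le_zero]

theorem finite_primitiveLattices {A : Type*} [NonUnitalNonAssocRing A] [Module O A]
    [Module.Finite O A] [Finite (IsLocalRing.ResidueField O)]
    {π : O} (hπ : Irreducible π) (i w : ℕ) : (primitiveLattices A π i w).Finite :=
  (finite_setOf_pow_smul_top_le hπ i).subset fun _ hΛ => pow_smul_top_le_of_index hπ hΛ.1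

theorem numPrimitiveLattices_eq_zero [Module.IsTorsionFree O A] [Module.Finite O A]
    [Finite (IsLocalRing.ResidueField O)] {π : O} (hπ : Irreducible π) {i w : ℕ} (hw : i < w) :
    numPrimitiveLattices A π i w = 0 := by
  rw [numPrimitiveLattices, Set.ncard_eq_zero (finite_primitiveLattices hπ i w)]
  refine Set.eq_empty_of_forall_notMem fun Λ hΛ => ?_
  have h1 := pow_smul_top_le_of_index hπ hΛ.1
  have h2 := (latticeWeight_le_iff hπ.ne_zero h1).2 (isClosedAt_of_smul_top_le h1)
  have h3 := hΛ.2.2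
  omega

theorem pow_dvd_numPrimitiveLattices [Module.Free O A] [Module.Finite O A]
    [Finite (IsLocalRing.ResidueField O)] {π : O} (hπ : Irreducible π) {n : ℕ} (hn : 2 ≤ n)
    (hdim : Module.finrank O A = n) (hgr : IsGradedAlgebra O A) (i w : ℕ) :
    Nat.card (IsLocalRing.ResidueField O) ^ (i / (n * (n - 1) ^ 2)) ∣
      numPrimitiveLattices A π i w := by
  have hk := Nat.mul_div_le i (n * (n - 1) ^ 2)
  generalize i / (n * (n - 1) ^ 2) = h at hk ⊢
  cases h with
  | zero => simp
  | succ k =>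
    have hcl := fun w => pow_dvd_ncard_closedPrimitiveLattices hπ hn hdim hgr w hk
    rw [numPrimitiveLattices]
    cases w with
    | zero => rw [primitiveLattices_zero hπ]; exact hcl 0
    | succ w =>
      have hsub : closedPrimitiveLattices A π i w ⊆ closedPrimitiveLattices A π i (w + 1) :=
        fun Λ hΛ => ⟨hΛ.1, hΛ.2.1, hΛ.2.2.mono w.le_succ⟩
      rw [primitiveLattices_succ hπ, Set.ncard_sdiff hsub
        (finite_closedPrimitiveLattices hπ i w)]
      exact Nat.dvd_sub (hcl _) (hcl _)

end Weight

/-! ### Convergence of the double series -/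

section Convergence

theorem finite_residueField_of_compact {O : Type*} [CommRing O] [IsLocalRing O]
    [TopologicalSpace O] [IsTopologicalRing O] (hadic : IsAdic (IsLocalRing.maximalIdeal O))
    [CompactSpace O] : Finite (IsLocalRing.ResidueField O) := by
  have h1 := (isAdic_iff.1 hadic).1 1
  rw [pow_one] at h1
  exact AddSubgroup.quotient_finite_of_isOpen (IsLocalRing.maximalIdeal O).toAddSubgroup h1

theorem summable_padic_norm_of_pow_dvd {p : ℕ} [Fact p.Prime] {N : ℕ} (hN : 0 < N)
    {a : ℕ → ℕ → ℕ} (ha : ∀ i w, p ^ (i / N) ∣ a i w) (ha' : ∀ i w, i < w → a i w = 0) :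
    Summable (fun x : ℕ × ℕ => ‖(a x.1 x.2 : ℤ_[p])‖) := by
  have hnorm : ∀ i w, ‖(a i w : ℤ_[p])‖ ≤ ((p : ℝ)⁻¹) ^ (i / N) := fun i w => by
    have h1 := (PadicInt.norm_le_pow_iff_mem_span_pow (p := p) (a i w : ℤ_[p]) (i / N)).2 (by
      rw [Ideal.mem_span_singleton]
      exact_mod_cast (Nat.cast_dvd_cast (ha i w) : ((p ^ (i / N) : ℕ) : ℤ_[p]) ∣ _))
    rwa [zpow_neg, zpow_natCast, ← inv_pow] at h1
  have hp1 : (1 : ℝ) < p := by exact_mod_cast (Fact.out : p.Prime).one_lt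
  have hr1 : (p : ℝ)⁻¹ < 1 := inv_lt_one_of_one_lt₀ hp1
  have hr0 : (0 : ℝ) ≤ (p : ℝ)⁻¹ := by positivity
  have hsupp : ∀ i, ∀ w ∉ Finset.range (i + 1), ‖(a i w : ℤ_[p])‖ = 0 := fun i w hw => by
    rw [ha' i w (by simpa using hw)]; simp
  rw [summable_prod_of_nonneg (fun _ => norm_nonneg _)]
  refine ⟨fun i => summable_of_ne_finset_zero (hsupp i), ?_⟩
  -- The inner sums are at most `(i + 1) p ^ (-⌊i / N⌋)`, hence at most `p (i + 1) ρ ^ i` with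
  -- `ρ = p ^ (-1 / N) < 1`.
  have hbound : ∀ i, ∑' w, ‖(a i w : ℤ_[p])‖ ≤ (i + 1 : ℝ) * ((p : ℝ)⁻¹) ^ (i / N) := fun i => by
    rw [tsum_eq_sum (hsupp i)]
    refine (Finset.sum_le_card_nsmul _ _ _ fun w _ => hnorm i w).trans ?_
    simp
  refine Summable.of_nonneg_of_le (fun i => tsum_nonneg fun w => norm_nonneg _) hbound ?_
  obtain ⟨ρ, hρ0, hρN⟩ : ∃ ρ : ℝ, 0 ≤ ρ ∧ ρ ^ N = (p : ℝ)⁻¹ :=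
    ⟨_, Real.rpow_nonneg hr0 _, Real.rpow_inv_natCast_pow hr0 hN.ne'⟩
  have hρ1 : ρ < 1 := by
    rwa [← pow_lt_one_iff_of_nonneg hρ0 hN.ne', hρN]
  have hgeom : Summable fun i : ℕ => (p : ℝ) * ((i : ℝ) ^ 1 * ρ ^ i + ρ ^ i) :=
    ((summable_pow_mul_geometric_of_norm_lt_one 1 (by rwa [Real.norm_of_nonneg hρ0])).add
      (summable_geometric_of_lt_one hρ0 hρ1)).mul_left _
  refine Summable.of_nonneg_of_le (fun i => by positivity) (fun i => ?_) hgeom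
  have h1 : ((p : ℝ)⁻¹) ^ (i / N) ≤ p * ρ ^ i := by
    have h2 : ρ ^ (N * (i / N + 1)) ≤ ρ ^ i :=
      pow_le_pow_of_le_one hρ0 hρ1.le (by have := Nat.lt_mul_div_succ i hN; omega)
    rw [pow_mul, hρN, pow_succ] at h2
    calc ((p : ℝ)⁻¹) ^ (i / N) = p * (((p : ℝ)⁻¹) ^ (i / N) * (p : ℝ)⁻¹) := by field_simp
      _ ≤ _ := by gcongr
  calc (i + 1 : ℝ) * ((p : ℝ)⁻¹) ^ (i / N) ≤ (i + 1 : ℝ) * (p * ρ ^ i) := by gcongr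
    _ = _ := by ring

end Convergence

theorem mainTheorem6 {O A : Type*} [CommRing O] [IsDomain O] [IsDiscreteValuationRing O]
    [CharZero O] [TopologicalSpace O] [IsTopologicalRing O]
    (hadic : IsAdic (IsLocalRing.maximalIdeal O)) [CompactSpace O]
    (p : ℕ) [Fact p.Prime] [CharP (IsLocalRing.ResidueField O) p]
    (π : O) (hπ : Irreducible π)
    [NonUnitalNonAssocRing A] [Module O A] [IsScalarTower O A A] [SMulCommClass O A A]
    [Module.Free O A] [Module.Finite O A]
    (n : ℕ) (hn : 2 ≤ n) (hdim : Module.finrank O A = n)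
    (hgr : IsGradedAlgebra O A) :
    (∀ i w : ℕ, (primitiveLattices A π i w).Finite ∧
      ((i / (n * (n - 1) ^ 2) : ℕ) : ℕ∞) ≤
        emultiplicity (Nat.card (IsLocalRing.ResidueField O)) (numPrimitiveLattices A π i w)) ∧
    Summable (fun x : ℕ × ℕ => ‖(numPrimitiveLattices A π x.1 x.2 : ℤ_[p])‖) := by
  have := finite_residueField_of_compact hadic
  have hdvd := pow_dvd_numPrimitiveLattices hπ hn hdim hgr
  refine ⟨fun i w => ⟨finite_primitiveLattices hπ i w, pow_dvd_iff_le_emultiplicity.1 (hdvd i w)⟩,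
    summable_padic_norm_of_pow_dvd (N := n * (n - 1) ^ 2) ?_ (fun i w => ?_)
      (fun i w hw => numPrimitiveLattices_eq_zero hπ hw)⟩
  · have : 0 < n - 1 := by omega
    positivity
  · have : Fintype (IsLocalRing.ResidueField O) := Fintype.ofFinite _
    obtain ⟨f, -, hf⟩ := FiniteField.card (IsLocalRing.ResidueField O) p
    refine Dvd.dvd.trans ?_ (hdvd i w)
    rw [Nat.card_eq_fintype_card, hf]
    exact pow_dvd_pow_of_dvd (dvd_pow_self p f.pos.ne') _
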